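/- Let $d\ge 0$ and $r\ge 1$ be integers and let $\langle\cdot,\cdot\rangle$ be the pairing between $(\mathbb R^d)^*$ and $\mathbb R^d$. A lattice polytope is the convex hull of a nonempty finite set of lattice points. Write $P^\vee=\{x : \langle y,x\rangle\le 1 \text{ for all } y\in P\}$ for the dual of a polytope $P$. A lattice polytope is reflexive if it contains the origin in its interior and its dual is a lattice polytope. Let $\Delta=\Delta^{(1)}+\dots+\Delta^{(r)}\subset(\mathbb R^d)^*$ be a nef-partition of a $d$-dimensional reflexive polytope. That is, $\Delta$ is reflexive, each $\Delta^{(i)}$ is a lattice polytope containing $0$, and for each $i$ there is a convex integral piecewise linear function $\psi_i$ (a maximum of finitely many integral linear forms) that equals $1$ at every nonzero vertex of $\Delta^{(i)}$ and $0$ on $\Delta^{(j)}$ for all $j\ne i$. Assume that the nef-partition is irreducible: for no nonempty proper subset $I\subset\{1,\dots,r\}$ does $\sum_{i\in I}\Delta^{(i)}$ contain $0$ in its relative interior. Let $\phi_i(x)=\max_{y\in\Delta^{(i)}}\langle y,x\rangle$, let $\nabla^{(i)}=\operatorname{Conv}\{0,\ x\in\Delta^\vee : \phi_i(x)=1\}$,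 and let $\nabla=\nabla^{(1)}+\dots+\nabla^{(r)}\subset\mathbb R^d$. Let $\omega$ be a real-valued function on the set $\nabla^\vee_{\mathbb Z}$ of lattice points of $\nabla^\vee$. The cells of the subdivision of $\nabla^\vee$ induced by $\omega$ are the projections of the lower faces of $\operatorname{Conv}\{(m,\omega(m)) : m\in\nabla^\vee_{\mathbb Z}\}$. Assume that this subdivision is central: every maximal cell contains the origin as a vertex. Let $S$ be the set of those cells that lie in the boundary $\partial\nabla^\vee$. A cell $\sigma\in S$ is transversal if $\sigma\cap\Delta^{(i)}\ne\emptyset$ for every $i$. For such $\sigma$ put $\bar\sigma=\operatorname{Conv}(\{0\}\cup\sigma)$ and $$F_{\bar\sigma}=\{y\in\mathbb R^d : \langle m,y\rangle-\omega(m)=\max_{m'\in\nabla^\vee_{\mathbb Z}}(\langle m',y\rangle-\omega(m'))\ \text{for all vertices } m \text{ of } \bar\sigma\}.$$ Let $\nabla_\omega\subset\mathbb R^d$ be the union of the cells $F_{\bar\sigma}$ over all transversal $\sigma\in S$, with the subspace topology. Then $r\le d+1$, and $\nabla_\omega$ is homeomorphic to the $(d-r)$-sphere, that is, to the unit sphere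 of $\mathbb R^{d-r+1}$ (the empty set if $r=d+1$). -/

import Mathlib

open scoped Pointwise

namespace NefSphere

/-- The real vector of a lattice vector. Both `ℝ^d` and its dual `(ℝ^d)^*` are written in
coordinates as `Fin d → ℝ`, with lattice `ℤ^d` and pairing the dot product `⬝ᵥ`. -/
def intVec {d : ℕ} (m : Fin d → ℤ) : Fin d → ℝ := fun k => (m k : ℝ)

/-- A lattice polytope: the convex hull of a nonempty finite set of lattice points. -/
def IsLatticePolytope {d : ℕ} (P : Set (Fin d → ℝ)) : Prop :=
  ∃ s : Finset (Fin d → ℤ), s.Nonempty ∧ P = convexHull ℝ (intVec '' (s : Set (Fin d → ℤ)))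

/-- The dual polytope `P^∨ = {x : ⟨y, x⟩ ≤ 1 for all y ∈ P}`. -/
def dualPolytope {d : ℕ} (P : Set (Fin d → ℝ)) : Set (Fin d → ℝ) :=
  {x | ∀ y ∈ P, y ⬝ᵥ x ≤ 1}

/-- A (full-dimensional) reflexive polytope in `ℝ^d`: a lattice polytope with the origin in its
interior whose dual polytope is again a lattice polytope. -/
def IsReflexive {d : ℕ} (P : Set (Fin d → ℝ)) : Prop :=
  IsLatticePolytope P ∧ 0 ∈ interior P ∧ IsLatticePolytope (dualPolytope P)

/-- A convex integral piecewise linear function: the maximum of finitely many linear forms with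
integer coefficients. -/
def IsConvexIntegralPL {d : ℕ} (ψ : (Fin d → ℝ) → ℝ) : Prop :=
  ∃ (N : Finset (Fin d → ℤ)) (hN : N.Nonempty), ∀ x, ψ x = N.sup' hN fun n => x ⬝ᵥ intVec n

/-- `Δ = Δ^(1) + ⋯ + Δ^(r)` (Minkowski sum) is a nef-partition of the reflexive polytope `Δ`. -/
structure IsNefPartition {d r : ℕ} (Δ : Fin r → Set (Fin d → ℝ)) : Prop where
  latticePolytope : ∀ i, IsLatticePolytope (Δ i)
  reflexive : IsReflexive (∑ i, Δ i)
  zero_mem : ∀ i, 0 ∈ Δ i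
  exists_PL : ∀ i, ∃ ψ : (Fin d → ℝ) → ℝ, IsConvexIntegralPL ψ ∧
    (∀ v ∈ (Δ i).extremePoints ℝ, v ≠ 0 → ψ v = 1) ∧
    ∀ j, j ≠ i → ∀ x ∈ Δ j, ψ x = 0

/-- No nonempty proper subset `I` of the indices is such that the Minkowski sum of the `Δ^(i)`,
`i ∈ I`, has the origin in its relative interior. -/
def IsIrreducible {d r : ℕ} (Δ : Fin r → Set (Fin d → ℝ)) : Prop :=
  ∀ I : Finset (Fin r), I.Nonempty → I ≠ Finset.univ →
    0 ∉ intrinsicInterior ℝ (∑ i ∈ I, Δ i)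

/-- The support function `x ↦ max_{y ∈ P} ⟨y, x⟩`. -/
noncomputable def supportFn {d : ℕ} (P : Set (Fin d → ℝ)) (x : Fin d → ℝ) : ℝ :=
  sSup ((fun y => y ⬝ᵥ x) '' P)

/-- The summand `∇^(i) = Conv {0, x ∈ Δ^∨ : φ_i(x) = 1}` of the dual nef-partition, where
`φ_i` is the support function of `Δ^(i)`. -/
def nablaPart {d r : ℕ} (Δ : Fin r → Set (Fin d → ℝ)) (i : Fin r) : Set (Fin d → ℝ) :=
  convexHull ℝ ({0} ∪ {x | x ∈ dualPolytope (∑ j, Δ j) ∧ supportFn (Δ i) x = 1})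

/-- The polytope `∇ = ∇^(1) + ⋯ + ∇^(r)` of the dual nef-partition. -/
def nabla {d r : ℕ} (Δ : Fin r → Set (Fin d → ℝ)) : Set (Fin d → ℝ) :=
  ∑ i, nablaPart Δ i

/-- The dual polytope `∇^∨`. -/
def nablaDual {d r : ℕ} (Δ : Fin r → Set (Fin d → ℝ)) : Set (Fin d → ℝ) :=
  dualPolytope (nabla Δ)

/-- The polytope lifted by `ω`: the convex hull of the points `(m, ω(m))`, for `m` a lattice
point of `P`. Only the values of `ω` at lattice points of `P` matter. -/
def lifted {d : ℕ} (P : Set (Fin d → ℝ)) (ω : (Fin d → ℤ) → ℝ) : Set ((Fin d → ℝ) × ℝ) :=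
  convexHull ℝ ((fun m => (intVec m, ω m)) '' {m | intVec m ∈ P})

/-- `σ` is a cell of the subdivision of `P` induced by `ω`: the projection of a lower face of the
lifted polytope, that is, of the face on which some functional `(y, -1)` is maximal. -/
def IsCell {d : ℕ} (P : Set (Fin d → ℝ)) (ω : (Fin d → ℤ) → ℝ) (σ : Set (Fin d → ℝ)) : Prop :=
  ∃ y : Fin d → ℝ, σ = Prod.fst '' {p | p ∈ lifted P ω ∧
    ∀ q ∈ lifted P ω, q.1 ⬝ᵥ y - q.2 ≤ p.1 ⬝ᵥ y - p.2}

/-- The subdivision of `P` induced by `ω` is central: every maximal cell contains the origin as a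
vertex. -/
def IsCentral {d : ℕ} (P : Set (Fin d → ℝ)) (ω : (Fin d → ℤ) → ℝ) : Prop :=
  ∀ σ, Maximal (IsCell P ω) σ → 0 ∈ σ.extremePoints ℝ

/-- The induced subdivision `S` of the boundary of `∇^∨`. -/
def boundaryCells {d r : ℕ} (Δ : Fin r → Set (Fin d → ℝ)) (ω : (Fin d → ℤ) → ℝ) :
    Set (Set (Fin d → ℝ)) :=
  {σ | IsCell (nablaDual Δ) ω σ ∧ σ ⊆ frontier (nablaDual Δ)}

/-- The set of transversal cells of `S`: those meeting every `Δ^(i)`. -/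
def transversalCells {d r : ℕ} (Δ : Fin r → Set (Fin d → ℝ)) (ω : (Fin d → ℤ) → ℝ) :
    Set (Set (Fin d → ℝ)) :=
  {σ | σ ∈ boundaryCells Δ ω ∧ ∀ i, (σ ∩ Δ i).Nonempty}

/-- The cone `σ ⋆ 0` over a cell with apex the origin. -/
def coneCell {d : ℕ} (σ : Set (Fin d → ℝ)) : Set (Fin d → ℝ) :=
  convexHull ℝ ({0} ∪ σ)

/-- The cell `F_σ` of the subdivision dual to the one induced by `ω`: all `y` such that
`⟨m, y⟩ - ω(m) = max_{m'} (⟨m', y⟩ - ω(m'))` for every vertex `m` of `σ`, where `m'` runs over the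
lattice points of `P`. -/
def dualCell {d : ℕ} (P : Set (Fin d → ℝ)) (ω : (Fin d → ℤ) → ℝ) (σ : Set (Fin d → ℝ)) :
    Set (Fin d → ℝ) :=
  {y | ∀ m : Fin d → ℤ, intVec m ∈ σ.extremePoints ℝ →
    ∀ m' : Fin d → ℤ, intVec m' ∈ P → intVec m' ⬝ᵥ y - ω m' ≤ intVec m ⬝ᵥ y - ω m}

/-- The underlying space of the complex `∇_ω`: the union of the cells `F_{σ ⋆ 0}` for transversal
cells `σ` of `S`. -/
def nablaOmega {d r : ℕ} (Δ : Fin r → Set (Fin d → ℝ)) (ω : (Fin d → ℤ) → ℝ) :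
    Set (Fin d → ℝ) :=
  ⋃ σ ∈ transversalCells Δ ω, dualCell (nablaDual Δ) ω (coneCell σ)

end NefSphere

/-! The sphere arises by moving the problem to a common level set of convex functions and then
changing those functions.

Write `φ_i` for the support function of `Δ^(i)`. Centrality gives a point `y₀` at which the origin
is the strict maximizer of `⟨m, ·⟩ - ω(m)` (`exists_strict_center`). A point `y` lies in `∇_ω`
exactly when the origin and a nonzero lattice point of every `Δ^(i)` are maximizers at `y`
(`nablaOmega_subset_tightLocus`, `tightLocus_subset_nablaOmega`). Each nonzero lattice point `m` of
`∇^∨` lies in some `Δ^(i)`, so dividing it by its gap `ω(m) - ω(0) - ⟨m, y₀⟩ > 0` turns this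
condition on `y - y₀` into `max_{b ∈ B_i} ⟨b, ·⟩ = 1` for all `i` (`mem_tightLocus_iff`).

Such a level set has a topology independent of `B`, provided that `B_i` lies in the cone over
`Δ^(i)` and the support functions are jointly positive (`nonempty_levelSet_homeomorph`). By
reflexivity every vector is a sum of `a_j` with `φ_i(a_j) ≤ 0` for `i ≠ j`. The decomposition with
least sum of Euclidean norms is unique, forms a closed family, and stays optimal when its summands
are rescaled independently. On the cone spanned by the `a_j`, raising the coefficient of one summand
can only lower the other support functions, so a nonlinear Perron-Frobenius argument finds exactly
one point at level `1`. Two level sets are thus both homeomorphic to the compact space of pairs of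
optimal decompositions on the same rays.

Irreducibility yields positive combinations `p_i` of the generators of `Δ^(i)` whose only linear
relations are multiples of `∑ p_i = 0` (`exists_circuit`). The functions `φ_i + S ⟨p_i, ·⟩` are
admissible, and for large `S` a Lipschitz-small perturbation of the identity carries the cone over
their level set onto the common kernel of the `p_i`, of dimension `d + 1 - r`. Radial projection
then gives the sphere. -/

namespace NefSphere

open Set Filter Topology

variable {d r : ℕ}

/-! ### Support functions of finite sets. -/

section SupportFn

variable {B : Set (Fin d → ℝ)}

theorem le_supportFn (hB : B.Finite) {b : Fin d → ℝ} (hb : b ∈ B) (x : Fin d → ℝ) :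
    b ⬝ᵥ x ≤ supportFn B x :=
  le_csSup (hB.image _).bddAbove (mem_image_of_mem _ hb)

theorem exists_eq_supportFn (hB : B.Finite) (hne : B.Nonempty) (x : Fin d → ℝ) :
    ∃ b ∈ B, b ⬝ᵥ x = supportFn B x :=
  (hne.image _).csSup_mem (hB.image _)

theorem supportFn_le (hne : B.Nonempty) {x : Fin d → ℝ} {c : ℝ} (h : ∀ b ∈ B, b ⬝ᵥ x ≤ c) :
    supportFn B x ≤ c :=
  csSup_le (hne.image _) (forall_mem_image.2 h)

theorem supportFn_zero (hne : B.Nonempty) : supportFn B 0 = 0 := by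
  simp [supportFn, hne.image_const]

theorem supportFn_add_le (hB : B.Finite) (hne : B.Nonempty) (x y : Fin d → ℝ) :
    supportFn B (x + y) ≤ supportFn B x + supportFn B y :=
  supportFn_le hne fun b hb => by
    rw [dotProduct_add]
    exact add_le_add (le_supportFn hB hb x) (le_supportFn hB hb y)

theorem supportFn_sum_le {ι : Type*} (hB : B.Finite) (hne : B.Nonempty) (s : Finset ι)
    (f : ι → Fin d → ℝ) : supportFn B (∑ i ∈ s, f i) ≤ ∑ i ∈ s, supportFn B (f i) :=
  supportFn_le hne fun b hb => by
    rw [dotProduct_sum]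
    exact Finset.sum_le_sum fun i _ => le_supportFn hB hb _

theorem supportFn_smul (hB : B.Finite) (hne : B.Nonempty) {c : ℝ} (hc : 0 ≤ c)
    (x : Fin d → ℝ) : supportFn B (c • x) = c * supportFn B x := by
  apply le_antisymm
  · refine supportFn_le hne fun b hb => ?_
    rw [dotProduct_smul, smul_eq_mul]
    exact mul_le_mul_of_nonneg_left (le_supportFn hB hb x) hc
  · obtain ⟨b, hb, hbx⟩ := exists_eq_supportFn hB hne x
    rw [← hbx, ← smul_eq_mul, ← dotProduct_smul]
    exact le_supportFn hB hb _

theorem dotProduct_le_mul_norm (b x : Fin d → ℝ) : b ⬝ᵥ x ≤ (∑ k, |b k|) * ‖x‖ := by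
  rw [Finset.sum_mul]
  refine Finset.sum_le_sum fun k _ => (le_abs_self _).trans ?_
  rw [abs_mul]
  exact mul_le_mul_of_nonneg_left (norm_le_pi_norm x k) (abs_nonneg _)

theorem exists_lipschitz_supportFn (hB : B.Finite) (hne : B.Nonempty) :
    ∃ C : ℝ, 0 ≤ C ∧ ∀ x y, |supportFn B x - supportFn B y| ≤ C * ‖x - y‖ := by
  obtain ⟨C, hC⟩ := (hB.image fun b : Fin d → ℝ => ∑ k, |b k|).bddAbove
  have key : ∀ x y, supportFn B x - supportFn B y ≤ C * ‖x - y‖ := fun x y => by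
    rw [sub_le_iff_le_add]
    refine supportFn_le hne fun b hb => ?_
    have h1 := le_supportFn hB hb y
    have h2 : b ⬝ᵥ (x - y) ≤ C * ‖x - y‖ := (dotProduct_le_mul_norm b _).trans
      (mul_le_mul_of_nonneg_right (hC (mem_image_of_mem _ hb)) (norm_nonneg _))
    rw [dotProduct_sub] at h2
    linarith
  refine ⟨C, ?_, fun x y => abs_sub_le_iff.2 ⟨key x y, ?_⟩⟩
  · obtain ⟨b, hb⟩ := hne
    exact le_trans (Finset.sum_nonneg fun k _ => abs_nonneg (b k)) (hC (mem_image_of_mem _ hb))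
  · rw [norm_sub_rev]
    exact key y x

theorem continuous_supportFn (hB : B.Finite) (hne : B.Nonempty) : Continuous (supportFn B) := by
  obtain ⟨C, hC0, hC⟩ := exists_lipschitz_supportFn hB hne
  refine (LipschitzWith.of_dist_le_mul (K := ⟨C, hC0⟩) fun x y => ?_).continuous
  rw [Real.dist_eq, dist_eq_norm]
  exact hC x y

theorem dotProduct_le_of_mem_convexHull {x y : Fin d → ℝ} {c : ℝ} (h : ∀ b ∈ B, b ⬝ᵥ x ≤ c)
    (hy : y ∈ convexHull ℝ B) : y ⬝ᵥ x ≤ c := by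
  have hconv : Convex ℝ {y : Fin d → ℝ | y ⬝ᵥ x ≤ c} :=
    convex_halfSpace_le (f := fun y : Fin d → ℝ => y ⬝ᵥ x)
      ⟨fun a b => add_dotProduct a b x, fun a b => smul_dotProduct a b x⟩ c
  exact convexHull_min (t := {y : Fin d → ℝ | y ⬝ᵥ x ≤ c}) h hconv hy

theorem supportFn_convexHull (hB : B.Finite) (hne : B.Nonempty) (x : Fin d → ℝ) :
    supportFn (convexHull ℝ B) x = supportFn B x := by
  have h : ∀ y ∈ convexHull ℝ B, y ⬝ᵥ x ≤ supportFn B x := fun y hy =>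
    dotProduct_le_of_mem_convexHull (fun b hb => le_supportFn hB hb x) hy
  apply le_antisymm
  · exact supportFn_le hne.convexHull h
  · obtain ⟨b, hb, hbx⟩ := exists_eq_supportFn hB hne x
    rw [← hbx]
    exact le_csSup ⟨supportFn B x, forall_mem_image.2 h⟩
      (mem_image_of_mem _ (subset_convexHull ℝ B hb))

/-- Piecewise linearity is the point. A form attaining the maximum at `a` loses exactly `ε` times
that maximum; for the others the inequality is strict at `x = a` and persists nearby, and there are
finitely many. -/
theorem eventually_supportFn_sub_smul_le (hB : B.Finite) (hne : B.Nonempty) {ε : ℝ}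
    (hε : ε < 1) (a : Fin d → ℝ) :
    ∀ᶠ x in 𝓝 a, supportFn B (x - ε • a) ≤ supportFn B x - ε * supportFn B a := by
  have : ∀ b ∈ B, ∀ᶠ x in 𝓝 a, b ⬝ᵥ (x - ε • a) ≤ supportFn B x - ε * supportFn B a := by
    intro b hb
    rcases (le_supportFn hB hb a).eq_or_lt with h | h
    · refine Eventually.of_forall fun x => ?_
      rw [dotProduct_sub, dotProduct_smul, h, smul_eq_mul]
      linarith [le_supportFn hB hb x]
    · have hc := continuous_supportFn hB hne
      have hd : Continuous fun x : Fin d → ℝ => b ⬝ᵥ (x - ε • a) :=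
        continuous_const.dotProduct (continuous_id.sub continuous_const)
      refine (hd.continuousAt.eventually_lt (g := fun x => supportFn B x - ε * supportFn B a)
        (by fun_prop) ?_).mono fun x hx => hx.le
      simp only [dotProduct_sub, dotProduct_smul, smul_eq_mul]
      nlinarith
  filter_upwards [(eventually_all_finite hB).2 this] with x hx
  exact supportFn_le hne hx

end SupportFn

/-! ### Homogeneous systems with off-diagonal monotonicity. -/

/-- On the unit sphere of the cone the sum of positive parts has a positive minimum, so by
homogeneity it dominates a multiple of the norm. -/
theorem isCompact_cone_sublevel {E ι : Type*} [NormedAddCommGroup E] [NormedSpace ℝ E]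
    [FiniteDimensional ℝ E] [Fintype ι] {K : Set E} (hK : IsClosed K)
    (hcone : ∀ c : ℝ, 0 ≤ c → ∀ x ∈ K, c • x ∈ K) {F : ι → E → ℝ} (hF : ∀ i, Continuous (F i))
    (hhom : ∀ i x, ∀ c : ℝ, 0 ≤ c → F i (c • x) = c * F i x)
    (hpos : ∀ x ∈ K, x ≠ 0 → ∃ i, 0 < F i x) (C : ℝ) :
    IsCompact {x | x ∈ K ∧ ∀ i, F i x ≤ C} := by
  have : ProperSpace E := FiniteDimensional.proper ℝ E
  have hcl : IsClosed {x | x ∈ K ∧ ∀ i, F i x ≤ C} := by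
    simp only [ofPred_and, ofPred_forall]
    exact hK.inter (isClosed_iInter fun i => isClosed_le (hF i) continuous_const)
  refine Metric.isCompact_of_isClosed_isBounded hcl ?_
  let h : E → ℝ := fun x => ∑ i, max (F i x) 0
  have hcont : Continuous h := continuous_finsetSum _ fun i _ => (hF i).max continuous_const
  have hcomp : IsCompact (K ∩ Metric.sphere 0 1) := (isCompact_sphere 0 1).inter_left hK
  have hh : ∀ x, ∀ c : ℝ, 0 ≤ c → h (c • x) = c * h x := fun x c hc => by
    simp only [h, Finset.mul_sum]
    refine Finset.sum_congr rfl fun i _ => ?_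
    rw [hhom i x c hc, mul_max_of_nonneg _ _ hc, mul_zero]
  obtain ⟨c, hc, hcS⟩ : ∃ c : ℝ, 0 < c ∧ ∀ x ∈ K ∩ Metric.sphere 0 1, c ≤ h x := by
    rcases (K ∩ Metric.sphere (0 : E) 1).eq_empty_or_nonempty with h0 | h0
    · exact ⟨1, one_pos, fun x hx => by simp [h0] at hx⟩
    · obtain ⟨x, hx, hmin⟩ := hcomp.exists_isMinOn h0 hcont.continuousOn
      refine ⟨h x, ?_, hmin⟩
      obtain ⟨i, hi⟩ := hpos x hx.1 (by rintro rfl; simpa using hx.2)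
      exact Finset.sum_pos' (fun i _ => le_max_right _ _)
        ⟨i, Finset.mem_univ i, lt_max_of_lt_left hi⟩
  refine (Metric.isBounded_closedBall (x := (0 : E)) (r := Fintype.card ι * max C 0 / c)).subset ?_
  rintro x ⟨hxK, hxC⟩
  rw [mem_closedBall_zero_iff, le_div_iff₀ hc]
  rcases eq_or_ne x 0 with rfl | hx
  · simp only [norm_zero, zero_mul]; positivity
  have h1 : h x ≤ Fintype.card ι * max C 0 := by
    refine (Finset.sum_le_sum fun i _ => max_le_max_right 0 (hxC i)).trans ?_
    simp
  have h2 : c ≤ h (‖x‖⁻¹ • x) := hcS _ ⟨hcone _ (by positivity) x hxK, by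
    simp [norm_smul, hx]⟩
  rw [hh x _ (by positivity)] at h2
  have h3 : ‖x‖ * c ≤ ‖x‖ * (‖x‖⁻¹ * h x) := mul_le_mul_of_nonneg_left h2 (norm_nonneg _)
  rw [← mul_assoc, mul_inv_cancel₀ (norm_ne_zero_iff.2 hx), one_mul] at h3
  exact h3.trans h1

/-- A continuous positively homogeneous map whose components are antitone in all the other
coordinates and jointly positive on the orthant. -/
structure IsOffAntitone (F : (Fin r → ℝ) → Fin r → ℝ) : Prop where
  continuous : ∀ i, Continuous fun t => F t i
  hom : ∀ i t, ∀ c : ℝ, 0 ≤ c → F (c • t) i = c * F t i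
  anti : ∀ i t t', t ≤ t' → t i = t' i → F t' i ≤ F t i
  pos : ∀ t, 0 ≤ t → t ≠ 0 → ∃ i, 0 < F t i

namespace IsOffAntitone

variable {F : (Fin r → ℝ) → Fin r → ℝ}

theorem map_zero (hF : IsOffAntitone F) (i : Fin r) : F 0 i = 0 := by
  simpa using hF.hom i 0 0 le_rfl

theorem pos_of_eq_one (hF : IsOffAntitone F) {t : Fin r → ℝ} (ht : 0 ≤ t)
    (h : ∀ i, F t i = 1) (i : Fin r) : 0 < t i := by
  refine (ht i).lt_of_ne fun h0 => ?_
  have := hF.anti i 0 t ht h0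
  rw [h, hF.map_zero] at this
  linarith

/-- Let `i` maximize the ratio `t i / t' i`, with value `λ`. Then `t ≤ λ t'` with equality in
coordinate `i`, so monotonicity gives `λ = F (λ t') i ≤ F t i = 1`. -/
theorem le_of_eq_one (hF : IsOffAntitone F) {t t' : Fin r → ℝ} (ht : 0 ≤ t) (ht' : 0 ≤ t')
    (h : ∀ i, F t i = 1) (h' : ∀ i, F t' i = 1) : t ≤ t' := by
  intro k
  have : Nonempty (Fin r) := ⟨k⟩
  obtain ⟨i, hi⟩ := Finite.exists_max fun i => t i / t' i
  have hpos := hF.pos_of_eq_one ht' h'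
  have hle : t ≤ (t i / t' i) • t' := fun j => by
    have := hi j
    rw [div_le_iff₀ (hpos j)] at this
    simpa using this
  have := hF.anti i t _ hle (by simp [(hpos i).ne'])
  rw [hF.hom i t' _ (div_nonneg (ht i) (ht' i)), h, h', mul_one] at this
  have := (hi k).trans this
  rwa [div_le_one (hpos k)] at this

theorem unique (hF : IsOffAntitone F) {t t' : Fin r → ℝ} (ht : 0 ≤ t) (ht' : 0 ≤ t')
    (h : ∀ i, F t i = 1) (h' : ∀ i, F t' i = 1) : t = t' :=
  le_antisymm (hF.le_of_eq_one ht ht' h h') (hF.le_of_eq_one ht' ht h' h)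

/-- Maximize the coordinate sum over the compact set `F ≤ 1` in the orthant. If some component were
below `1`, raising that coordinate slightly would keep it below `1` and could only lower the other
components. -/
theorem exists_eq_one (hF : IsOffAntitone F) : ∃ t, 0 ≤ t ∧ ∀ i, F t i = 1 := by
  have hcomp : IsCompact {t : Fin r → ℝ | t ∈ Ici 0 ∧ ∀ i, F t i ≤ 1} :=
    isCompact_cone_sublevel (F := fun i t => F t i) isClosed_Ici
      (fun c hc x hx => smul_nonneg hc hx) hF.continuous hF.hom (fun x hx => hF.pos x hx) 1
  obtain ⟨t, ⟨ht0, ht1⟩, hmax⟩ := hcomp.exists_isMaxOn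
    ⟨0, mem_Ici.2 le_rfl, fun i => by rw [hF.map_zero]; exact zero_le_one⟩
    (f := fun t => ∑ i, t i) (by fun_prop)
  refine ⟨t, ht0, fun i => (ht1 i).antisymm (not_lt.1 fun hi => ?_)⟩
  have hc : Continuous fun s : ℝ => F (t + s • Pi.single i 1) i :=
    (hF.continuous i).comp (by fun_prop)
  have hev : ∀ᶠ s in 𝓝[>] (0 : ℝ), F (t + s • Pi.single i 1) i < 1 :=
    nhdsWithin_le_nhds (hc.continuousAt.eventually_lt continuousAt_const (by simpa using hi))
  obtain ⟨s, hs, hs0⟩ := (hev.and self_mem_nhdsWithin).exists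
  have hs0 : 0 < s := hs0
  have hle : t ≤ t + s • Pi.single i 1 := le_add_of_nonneg_right
    (smul_nonneg hs0.le (Pi.single_nonneg.2 zero_le_one))
  have := hmax (a := t + s • Pi.single i 1) ⟨le_trans ht0 hle, fun j => ?_⟩
  · simp [Finset.sum_add_distrib, ← Finset.mul_sum] at this
    linarith
  · rcases eq_or_ne j i with rfl | hj
    · exact hs.le
    · exact (hF.anti j _ _ hle (by simp [hj])).trans (ht1 j)

end IsOffAntitone

/-! ### Decompositions of least norm. -/

section

/-- The summands of a decomposition of a vector along the support functions of the `g i`: the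
`j`-th summand is nonpositive for all `g i`, `i ≠ j`, and carries the full value of `g j`. -/
structure IsDecomp (g : Fin r → Set (Fin d → ℝ)) (a : Fin r → Fin d → ℝ) : Prop where
  off_le : ∀ i j, i ≠ j → supportFn (g i) (a j) ≤ 0
  diag_le : ∀ j, supportFn (g j) (a j) ≤ supportFn (g j) (∑ k, a k)

/-- Finite sets whose support functions are nonnegative and jointly positive, and along which
every vector decomposes. -/
structure IsDecomposing (g : Fin r → Set (Fin d → ℝ)) : Prop where
  finite : ∀ i, (g i).Finite
  nonempty : ∀ i, (g i).Nonempty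
  nonneg : ∀ i x, 0 ≤ supportFn (g i) x
  pos : ∀ x, x ≠ 0 → ∃ i, 0 < supportFn (g i) x
  exists_decomp : ∀ y, ∃ a, IsDecomp g a ∧ ∑ j, a j = y

/-- The sum of the Euclidean norms. -/
noncomputable def sumNorm (a : Fin r → Fin d → ℝ) : ℝ := ∑ j, ‖WithLp.toLp 2 (a j)‖

theorem continuous_sumNorm : Continuous (sumNorm (d := d) (r := r)) := by
  unfold sumNorm
  exact continuous_finsetSum _ fun j _ =>
    ((PiLp.continuous_toLp 2 _).comp (continuous_apply j)).norm

theorem sumNorm_add_le (a b : Fin r → Fin d → ℝ) :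
    sumNorm (a + b) ≤ sumNorm a + sumNorm b := by
  unfold sumNorm
  rw [← Finset.sum_add_distrib]
  exact Finset.sum_le_sum fun j _ => norm_add_le (WithLp.toLp 2 (a j)) (WithLp.toLp 2 (b j))

theorem sumNorm_smul {c : ℝ} (hc : 0 ≤ c) (a : Fin r → Fin d → ℝ) :
    sumNorm (c • a) = c * sumNorm a := by
  simp [sumNorm, Finset.mul_sum, norm_smul, abs_of_nonneg hc]

/-- A decomposition of least norm among those of the same vector. -/
structure IsOptDecomp (g : Fin r → Set (Fin d → ℝ)) (a : Fin r → Fin d → ℝ) : Prop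
    extends IsDecomp g a where
  le_sumNorm : ∀ b, IsDecomp g b → ∑ j, b j = ∑ j, a j → sumNorm a ≤ sumNorm b

variable {g : Fin r → Set (Fin d → ℝ)}

namespace IsDecomposing

theorem diag_eq (hg : IsDecomposing g) {a : Fin r → Fin d → ℝ} (ha : IsDecomp g a) (j : Fin r) :
    supportFn (g j) (a j) = supportFn (g j) (∑ k, a k) := by
  refine (ha.diag_le j).antisymm ?_
  refine (supportFn_sum_le (hg.finite j) (hg.nonempty j) Finset.univ a).trans ?_
  rw [← Finset.add_sum_erase _ _ (Finset.mem_univ j)]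
  linarith [Finset.sum_nonpos (s := Finset.univ.erase j) (f := fun k => supportFn (g j) (a k))
    fun k hk => ha.off_le j k (Finset.ne_of_mem_erase hk).symm]

/-- A form of `g j` that is maximal at `∑ a k` must vanish on every `a k` with `k ≠ j`, since all
slack in subadditivity is used up. It therefore still realizes the bound after rescaling. -/
theorem supportFn_sum_smul (hg : IsDecomposing g) {a : Fin r → Fin d → ℝ} (ha : IsDecomp g a)
    {t : Fin r → ℝ} (ht : 0 ≤ t) (j : Fin r) :
    supportFn (g j) (∑ k, t k • a k) = t j * supportFn (g j) (a j) := by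
  apply le_antisymm
  · refine (supportFn_sum_le (hg.finite j) (hg.nonempty j) Finset.univ _).trans ?_
    simp only [supportFn_smul (hg.finite j) (hg.nonempty j) (ht _)]
    rw [← Finset.add_sum_erase _ _ (Finset.mem_univ j)]
    linarith [Finset.sum_nonpos (s := Finset.univ.erase j)
      (f := fun k => t k * supportFn (g j) (a k)) fun k hk =>
        mul_nonpos_of_nonneg_of_nonpos (ht k) (ha.off_le j k (Finset.ne_of_mem_erase hk).symm)]
  · obtain ⟨n, hn, hnx⟩ := exists_eq_supportFn (hg.finite j) (hg.nonempty j) (∑ k, a k)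
    have h0 : ∀ k ∈ Finset.univ.erase j, n ⬝ᵥ a k ≤ 0 := fun k hk =>
      (le_supportFn (hg.finite j) hn _).trans (ha.off_le j k (Finset.ne_of_mem_erase hk).symm)
    have h1 : n ⬝ᵥ a j ≤ supportFn (g j) (a j) := le_supportFn (hg.finite j) hn _
    rw [← hg.diag_eq ha, dotProduct_sum, ← Finset.add_sum_erase _ _ (Finset.mem_univ j)] at hnx
    have h2 : ∑ k ∈ Finset.univ.erase j, n ⬝ᵥ a k = 0 :=
      le_antisymm (Finset.sum_nonpos h0) (by linarith)
    have h3 := (Finset.sum_eq_zero_iff_of_nonpos h0).1 h2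
    refine le_trans (le_of_eq ?_) (le_supportFn (hg.finite j) hn _)
    rw [dotProduct_sum, ← Finset.add_sum_erase _ _ (Finset.mem_univ j),
      Finset.sum_eq_zero fun k hk => by rw [dotProduct_smul, h3 k hk, smul_zero],
      dotProduct_smul, smul_eq_mul, ← hnx, h2, add_zero, add_zero]

theorem isDecomp_smul (hg : IsDecomposing g) {a : Fin r → Fin d → ℝ} (ha : IsDecomp g a)
    {t : Fin r → ℝ} (ht : 0 ≤ t) : IsDecomp g fun k => t k • a k where
  off_le i j hij := by
    rw [supportFn_smul (hg.finite i) (hg.nonempty i) (ht _)]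
    exact mul_nonpos_of_nonneg_of_nonpos (ht j) (ha.off_le i j hij)
  diag_le j := by
    rw [supportFn_smul (hg.finite j) (hg.nonempty j) (ht _), hg.supportFn_sum_smul ha ht]

theorem isClosed_isDecomp (hg : IsDecomposing g) : IsClosed {a | IsDecomp g a} := by
  have hc := fun i => continuous_supportFn (hg.finite i) (hg.nonempty i)
  have : {a | IsDecomp g a} = (⋂ i, ⋂ j, ⋂ _ : i ≠ j, {a | supportFn (g i) (a j) ≤ 0}) ∩
      ⋂ j, {a | supportFn (g j) (a j) ≤ supportFn (g j) (∑ k, a k)} := by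
    ext a
    simp only [mem_ofPred_eq, mem_inter_iff, mem_iInter]
    exact ⟨fun h => ⟨h.1, h.2⟩, fun h => ⟨h.1, h.2⟩⟩
  rw [this]
  refine IsClosed.inter ?_ ?_
  · exact isClosed_iInter fun i => isClosed_iInter fun j => isClosed_iInter fun _ =>
      isClosed_le ((hc i).comp (continuous_apply j)) continuous_const
  · exact isClosed_iInter fun j => isClosed_le ((hc j).comp (continuous_apply j))
      ((hc j).comp (by fun_prop))

theorem isCompact_sublevel (hg : IsDecomposing g) (C : ℝ) :
    IsCompact {x : Fin d → ℝ | ∀ i, supportFn (g i) x ≤ C} := by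
  simpa using isCompact_cone_sublevel (K := univ) isClosed_univ (fun _ _ _ _ => mem_univ _)
    (fun i => continuous_supportFn (hg.finite i) (hg.nonempty i))
    (fun i x c hc => supportFn_smul (hg.finite i) (hg.nonempty i) hc x) (fun x _ => hg.pos x) C

theorem isCompact_decomp (hg : IsDecomposing g) {K : Set (Fin d → ℝ)} (hK : IsCompact K) :
    IsCompact {a | IsDecomp g a ∧ ∑ j, a j ∈ K} := by
  have hc := fun i => continuous_supportFn (hg.finite i) (hg.nonempty i)
  obtain ⟨C, hC⟩ : ∃ C : ℝ, ∀ x ∈ K, ∀ i, supportFn (g i) x ≤ C := by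
    obtain ⟨C, hC⟩ := hK.bddAbove_image
      (f := fun x => ∑ i, supportFn (g i) x) (continuous_finsetSum _ fun i _ => hc i).continuousOn
    exact ⟨C, fun x hx i => (Finset.single_le_sum (f := fun i => supportFn (g i) x)
      (fun i _ => hg.nonneg i x) (Finset.mem_univ i)).trans (hC (mem_image_of_mem _ hx))⟩
  refine (isCompact_univ_pi fun _ : Fin r => hg.isCompact_sublevel (max C 0)).of_isClosed_subset
    (hg.isClosed_isDecomp.inter (hK.isClosed.preimage
      (f := fun a : Fin r → Fin d → ℝ => ∑ j, a j) (by fun_prop))) ?_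
  rintro a ⟨ha, haK⟩ j - i
  rcases eq_or_ne i j with rfl | hij
  · exact (ha.diag_le i).trans ((hC _ haK i).trans (le_max_left _ _))
  · exact (ha.off_le i j hij).trans (le_max_right _ _)

theorem exists_isOptDecomp (hg : IsDecomposing g) (y : Fin d → ℝ) :
    ∃ a, IsOptDecomp g a ∧ ∑ j, a j = y := by
  obtain ⟨a, ⟨ha, hay⟩, hmin⟩ := (hg.isCompact_decomp (isCompact_singleton (x := y))).exists_isMinOn
    (hg.exists_decomp y) continuous_sumNorm.continuousOn
  exact ⟨a, ⟨ha, fun b hb hba => hmin ⟨hb, hba.trans hay⟩⟩, hay⟩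

theorem pos_diag (hg : IsDecomposing g) {a : Fin r → Fin d → ℝ} (ha : IsDecomp g a) {j : Fin r}
    (hj : a j ≠ 0) : 0 < supportFn (g j) (a j) := by
  obtain ⟨i, hi⟩ := hg.pos _ hj
  rcases eq_or_ne i j with rfl | hij
  · exact hi
  · exact absurd hi (ha.off_le i j hij).not_gt

theorem isDecomp_midpoint (hg : IsDecomposing g) {a b : Fin r → Fin d → ℝ} (ha : IsDecomp g a)
    (hb : IsDecomp g b) (h : ∑ j, a j = ∑ j, b j) : IsDecomp g ((1 / 2 : ℝ) • (a + b)) where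
  off_le i j hij := by
    have := supportFn_add_le (hg.finite i) (hg.nonempty i) (a j) (b j)
    simp only [Pi.smul_apply, Pi.add_apply]
    rw [supportFn_smul (hg.finite i) (hg.nonempty i) (by norm_num)]
    linarith [ha.off_le i j hij, hb.off_le i j hij]
  diag_le j := by
    have := supportFn_add_le (hg.finite j) (hg.nonempty j) (a j) (b j)
    have hs : ∑ k, ((1 / 2 : ℝ) • (a + b)) k = ∑ k, a k := by
      simp only [Pi.smul_apply, Pi.add_apply]
      rw [← Finset.smul_sum, Finset.sum_add_distrib, ← h, ← two_smul ℝ (∑ k, a k), smul_smul]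
      norm_num
    rw [hs]
    simp only [Pi.smul_apply, Pi.add_apply]
    rw [supportFn_smul (hg.finite j) (hg.nonempty j) (by norm_num)]
    have h2 := hb.diag_le j
    rw [← h] at h2
    linarith [ha.diag_le j]

/-- The midpoint is again a decomposition, so optimality forces equality in the triangle inequality
and each pair of summands lies on one ray. The prescribed value of `supportFn (g j)` then fixes the
length. -/
theorem isOptDecomp_unique (hg : IsDecomposing g) {a b : Fin r → Fin d → ℝ}
    (ha : IsOptDecomp g a) (hb : IsOptDecomp g b) (h : ∑ j, a j = ∑ j, b j) : a = b := by
  have hN : sumNorm a = sumNorm b :=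
    (ha.le_sumNorm b hb.1 h.symm).antisymm (hb.le_sumNorm a ha.1 h)
  have hm := ha.le_sumNorm _ (hg.isDecomp_midpoint ha.1 hb.1 h) (by
    simp only [Pi.smul_apply, Pi.add_apply]
    rw [← Finset.smul_sum, Finset.sum_add_distrib, ← h, ← two_smul ℝ (∑ k, a k), smul_smul]
    norm_num)
  rw [sumNorm_smul (by norm_num)] at hm
  have hle : ∀ j ∈ Finset.univ, ‖WithLp.toLp 2 ((a + b) j)‖ ≤
      ‖WithLp.toLp 2 (a j)‖ + ‖WithLp.toLp 2 (b j)‖ :=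
    fun j _ => norm_add_le (WithLp.toLp 2 (a j)) (WithLp.toLp 2 (b j))
  have heq := (Finset.sum_eq_sum_iff_of_le hle).1 (by
    refine (Finset.sum_le_sum hle).antisymm ?_
    rw [Finset.sum_add_distrib]
    change sumNorm a + sumNorm b ≤ sumNorm (a + b)
    linarith)
  funext j
  have hray : SameRay ℝ (WithLp.toLp 2 (a j)) (WithLp.toLp 2 (b j)) :=
    sameRay_iff_norm_add.2 (heq j (Finset.mem_univ j))
  have hφ : supportFn (g j) (a j) = supportFn (g j) (b j) := by
    rw [hg.diag_eq ha.1, hg.diag_eq hb.1, h]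
  have hz := supportFn_zero (hg.nonempty j)
  by_cases h0 : a j = 0
  · by_contra hne
    have := hg.pos_diag hb.1 (j := j) (fun hb0 => hne (h0.trans hb0.symm))
    rw [← hφ, h0, hz] at this
    exact this.false
  by_cases h0' : b j = 0
  · have := hg.pos_diag ha.1 h0
    rw [hφ, h0', hz] at this
    exact (this.false).elim
  obtain ⟨c₁, c₂, hc₁, hc₂, hc⟩ := hray.exists_pos (by simpa using h0) (by simpa using h0')
  have hc' : c₁ • a j = c₂ • b j := by
    rw [← WithLp.toLp_smul, ← WithLp.toLp_smul] at hc
    exact WithLp.toLp_injective 2 hc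
  have := congrArg (supportFn (g j)) hc'
  rw [supportFn_smul (hg.finite j) (hg.nonempty j) hc₁.le,
    supportFn_smul (hg.finite j) (hg.nonempty j) hc₂.le, hφ] at this
  have hcc := mul_right_cancel₀ (hφ ▸ (hg.pos_diag ha.1 h0)).ne' this
  rw [hcc] at hc'
  exact smul_right_injective _ hc₂.ne' hc'

/-- A better competitor `z` for the rescaled vector would give the competitor `(1 - ε t j) a j + ε z
j` for the original one. The sum of norms, unlike a sum of squares, is linear along rays, so
comparing the two reduces exactly to comparing `z` with `t • a`. -/
theorem isOptDecomp_smul (hg : IsDecomposing g) {a : Fin r → Fin d → ℝ}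
    (ha : IsOptDecomp g a) {t : Fin r → ℝ} (ht : 0 ≤ t) : IsOptDecomp g fun k => t k • a k := by
  refine ⟨hg.isDecomp_smul ha.1 ht, fun z hz hzt => ?_⟩
  obtain ⟨ε, hε, hεt⟩ : ∃ ε : ℝ, 0 < ε ∧ ∀ j, ε * t j ≤ 1 := by
    have hs : 0 ≤ ∑ j, t j := Finset.sum_nonneg fun j _ => ht j
    refine ⟨(1 + ∑ j, t j)⁻¹, by positivity, fun j => ?_⟩
    rw [inv_mul_le_one₀ (by positivity)]
    linarith [Finset.single_le_sum (f := t) (fun j _ => ht j) (Finset.mem_univ j)]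
  have hw : ∀ i j, supportFn (g i) ((1 - ε * t j) • a j + ε • z j) ≤
      (1 - ε * t j) * supportFn (g i) (a j) + ε * supportFn (g i) (z j) := fun i j => by
    refine (supportFn_add_le (hg.finite i) (hg.nonempty i) _ _).trans_eq ?_
    rw [supportFn_smul (hg.finite i) (hg.nonempty i) (by linarith [hεt j]),
      supportFn_smul (hg.finite i) (hg.nonempty i) hε.le]
  have hsum : ∑ j, ((1 - ε * t j) • a j + ε • z j) = ∑ j, a j := by
    simp only [sub_smul, one_smul, Finset.sum_add_distrib, Finset.sum_sub_distrib,
      ← Finset.smul_sum, hzt, mul_smul]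
    abel
  have hdec : IsDecomp g fun j => (1 - ε * t j) • a j + ε • z j := by
    refine ⟨fun i j hij => (hw i j).trans ?_, fun j => (hw j j).trans ?_⟩
    · have := mul_nonpos_of_nonneg_of_nonpos (sub_nonneg.2 (hεt j)) (ha.off_le i j hij)
      have := mul_nonpos_of_nonneg_of_nonpos hε.le (hz.off_le i j hij)
      linarith
    · rw [hsum, hg.diag_eq hz, hzt, hg.supportFn_sum_smul ha.1 ht, ← hg.diag_eq ha.1]
      exact le_of_eq (by ring)
  have h1 := ha.le_sumNorm _ hdec hsum
  have h2 : sumNorm (fun j => (1 - ε * t j) • a j + ε • z j) ≤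
      sumNorm (fun j => (1 - ε * t j) • a j) + ε * sumNorm z := by
    rw [← sumNorm_smul hε.le]
    exact sumNorm_add_le _ (ε • z)
  have h3 : sumNorm (fun j => (1 - ε * t j) • a j) =
      sumNorm a - ε * sumNorm (fun k => t k • a k) := by
    simp only [sumNorm, WithLp.toLp_smul, norm_smul, Real.norm_eq_abs, Finset.mul_sum,
      ← Finset.sum_sub_distrib]
    refine Finset.sum_congr rfl fun j _ => ?_
    rw [abs_of_nonneg (sub_nonneg.2 (hεt j)), abs_of_nonneg (ht j)]
    ring
  exact le_of_mul_le_mul_left (by linarith) hε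

/-- If a limit `a` of optimal decompositions had a better competitor `z`, then for optimal `b` near
`a` the family `b - a/2 + z/2` would be a decomposition of the same vector as `b` with smaller norm.
Local piecewise linearity of the support functions keeps it a decomposition. -/
theorem isClosed_isOptDecomp (hg : IsDecomposing g) : IsClosed {a | IsOptDecomp g a} := by
  refine isClosed_of_closure_subset fun a hacl => ?_
  have ha : IsDecomp g a := closure_minimal (fun b (hb : IsOptDecomp g b) => hb.1)
    hg.isClosed_isDecomp hacl
  refine ⟨ha, fun z hz hza => not_lt.1 fun hlt => ?_⟩
  have hP : ∀ᶠ b in 𝓝 a, ∀ i j, supportFn (g i) (b j - (1 / 2 : ℝ) • a j) ≤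
      supportFn (g i) (b j) - 1 / 2 * supportFn (g i) (a j) :=
    eventually_all.2 fun i => eventually_all.2 fun j =>
      (continuous_apply j).continuousAt.eventually
        (eventually_supportFn_sub_smul_le (hg.finite i) (hg.nonempty i) (by norm_num) (a j))
  have hN : ∀ᶠ b in 𝓝 a, sumNorm (b - (1 / 2 : ℝ) • a) + 1 / 2 * sumNorm z < sumNorm b := by
    have hc : Continuous fun b : Fin r → Fin d → ℝ =>
        sumNorm (b - (1 / 2 : ℝ) • a) + 1 / 2 * sumNorm z :=
      (continuous_sumNorm.comp (continuous_id.sub continuous_const)).add continuous_const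
    refine hc.continuousAt.eventually_lt continuous_sumNorm.continuousAt ?_
    have : a - (1 / 2 : ℝ) • a = (1 / 2 : ℝ) • a := by module
    rw [this, sumNorm_smul (by norm_num)]
    linarith
  obtain ⟨b, hb, hb1, hb2⟩ :=
    ((mem_closure_iff_frequently.1 hacl).and_eventually (hP.and hN)).exists
  have hb : IsOptDecomp g b := hb
  have hw : ∀ i j, supportFn (g i) ((b - (1 / 2 : ℝ) • a + (1 / 2 : ℝ) • z) j) ≤
      supportFn (g i) (b j) - 1 / 2 * supportFn (g i) (a j) + 1 / 2 * supportFn (g i) (z j) :=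
    fun i j => by
      refine (supportFn_add_le (hg.finite i) (hg.nonempty i) _ _).trans ?_
      rw [Pi.smul_apply (1 / 2 : ℝ) z, supportFn_smul (hg.finite i) (hg.nonempty i) (by norm_num)]
      exact add_le_add_left (hb1 i j) _
  have hsum : ∑ j, (b - (1 / 2 : ℝ) • a + (1 / 2 : ℝ) • z) j = ∑ j, b j := by
    simp only [Pi.add_apply, Pi.sub_apply, Pi.smul_apply, Finset.sum_add_distrib,
      Finset.sum_sub_distrib, ← Finset.smul_sum, hza, sub_add_cancel]
  have hdec : IsDecomp g (b - (1 / 2 : ℝ) • a + (1 / 2 : ℝ) • z) := by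
    refine ⟨fun i j hij => (hw i j).trans ?_, fun j => (hw j j).trans ?_⟩
    · linarith [hb.off_le i j hij, hz.off_le i j hij, hg.nonneg i (a j)]
    · rw [hsum, hg.diag_eq hz, hza, ← hg.diag_eq ha, ← hg.diag_eq hb.1]
      linarith
  have h1 := hb.le_sumNorm _ hdec hsum
  have h2 := sumNorm_add_le (b - (1 / 2 : ℝ) • a) ((1 / 2 : ℝ) • z)
  rw [sumNorm_smul (by norm_num)] at h2
  linarith

end IsDecomposing

end

/-! ### Independence of the level set from the admissible family. -/

section

/-- The common level set `{y | max_{b ∈ B i} ⟨b, y⟩ = 1 for all i}`. -/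
def levelSet (B : Fin r → Set (Fin d → ℝ)) : Set (Fin d → ℝ) :=
  {y | ∀ i, supportFn (B i) y = 1}

/-- Finite sets `B i` in the cones over the `g i` whose support functions are jointly positive. -/
structure IsAdmissible (g B : Fin r → Set (Fin d → ℝ)) : Prop where
  finite : ∀ i, (B i).Finite
  nonempty : ∀ i, (B i).Nonempty
  nonpos : ∀ i, ∀ b ∈ B i, ∀ x, supportFn (g i) x ≤ 0 → b ⬝ᵥ x ≤ 0
  pos : ∀ x, x ≠ 0 → ∃ i, 0 < supportFn (B i) x

variable {g B B' : Fin r → Set (Fin d → ℝ)}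

namespace IsAdmissible

theorem continuous (hB : IsAdmissible g B) (i : Fin r) : Continuous (supportFn (B i)) :=
  continuous_supportFn (hB.finite i) (hB.nonempty i)

theorem isCompact_levelSet (hB : IsAdmissible g B) : IsCompact (levelSet B) := by
  have h1 : IsCompact {x : Fin d → ℝ | ∀ i, supportFn (B i) x ≤ 1} := by
    simpa using isCompact_cone_sublevel (K := univ) isClosed_univ (fun _ _ _ _ => mem_univ _)
      hB.continuous
      (fun i x c hc => supportFn_smul (hB.finite i) (hB.nonempty i) hc x) (fun x _ => hB.pos x) 1
  refine h1.of_isClosed_subset ?_ fun x hx i => (hx i).le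
  simp only [levelSet, ofPred_forall]
  exact isClosed_iInter fun i => isClosed_eq (hB.continuous i) continuous_const

theorem isOffAntitone (hg : IsDecomposing g) (hB : IsAdmissible g B) {a : Fin r → Fin d → ℝ}
    (ha : IsDecomp g a) (ha0 : ∀ j, a j ≠ 0) :
    IsOffAntitone fun t i => supportFn (B i) (∑ j, t j • a j) where
  continuous i := (hB.continuous i).comp (by fun_prop)
  hom i t c hc := by
    rw [← supportFn_smul (hB.finite i) (hB.nonempty i) hc]
    simp [Finset.smul_sum, mul_smul]
  anti i t t' hle hi := by
    refine supportFn_le (hB.nonempty i) fun b hb => le_trans ?_ (le_supportFn (hB.finite i) hb _)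
    simp only [dotProduct_sum, dotProduct_smul, smul_eq_mul]
    refine Finset.sum_le_sum fun j _ => ?_
    rcases eq_or_ne i j with rfl | hij
    · rw [hi]
    · exact mul_le_mul_of_nonpos_right (hle j) (hB.nonpos i b hb _ (ha.off_le i j hij))
  pos t ht ht0 := by
    -- It suffices that the combination is nonzero, and `supportFn (g j)` detects the coefficient `t
    -- j > 0`.
    obtain ⟨j, hj⟩ := Function.ne_iff.1 ht0
    refine hB.pos _ fun h0 => ?_
    have h1 := hg.supportFn_sum_smul ha ht j
    rw [h0, supportFn_zero (hg.nonempty j)] at h1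
    have h2 : 0 < t j := (ht j).lt_of_ne (Ne.symm hj)
    exact (mul_pos h2 (hg.pos_diag ha (ha0 j))).ne h1

/-- If `a j` vanished, every element of `B j` would be nonpositive on the sum, where the maximum is
`1`. -/
theorem ne_zero (hB : IsAdmissible g B) {a : Fin r → Fin d → ℝ} (ha : IsDecomp g a)
    (h : ∑ j, a j ∈ levelSet B) (j : Fin r) : a j ≠ 0 := by
  intro h0
  obtain ⟨b, hb, hbx⟩ := exists_eq_supportFn (hB.finite j) (hB.nonempty j) (∑ k, a k)
  rw [h j, dotProduct_sum] at hbx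
  have : ∑ k, b ⬝ᵥ a k ≤ 0 := Finset.sum_nonpos fun k _ => by
    rcases eq_or_ne j k with rfl | hjk
    · simp [h0]
    · exact hB.nonpos j b hb _ (ha.off_le j k hjk)
  linarith

end IsAdmissible

/-- Pairs of optimal decompositions of points of two level sets with summands on the same rays. -/
def rayPairs (g B B' : Fin r → Set (Fin d → ℝ)) :
    Set ((Fin r → Fin d → ℝ) × (Fin r → Fin d → ℝ)) :=
  {p | (IsOptDecomp g p.1 ∧ ∑ j, p.1 j ∈ levelSet B) ∧
    (IsOptDecomp g p.2 ∧ ∑ j, p.2 j ∈ levelSet B') ∧ ∀ j, SameRay ℝ (p.1 j) (p.2 j)}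

theorem isCompact_rayPairs (hg : IsDecomposing g) (hB : IsAdmissible g B)
    (hB' : IsAdmissible g B') : IsCompact (rayPairs g B B') := by
  have key : ∀ {C : Fin r → Set (Fin d → ℝ)}, IsAdmissible g C →
      IsCompact {a | IsOptDecomp g a ∧ ∑ j, a j ∈ levelSet C} := fun {C} hC =>
    (hg.isCompact_decomp hC.isCompact_levelSet).of_isClosed_subset
      (hg.isClosed_isOptDecomp.inter (hC.isCompact_levelSet.isClosed.preimage
        (f := fun a : Fin r → Fin d → ℝ => ∑ j, a j) (by fun_prop)))
      fun a ha => ⟨ha.1.1, ha.2⟩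
  refine ((key hB).prod (key hB')).of_isClosed_subset ?_ fun p hp => ⟨hp.1, hp.2.1⟩
  have : rayPairs g B B' = ({a | IsOptDecomp g a ∧ ∑ j, a j ∈ levelSet B} ×ˢ
      {a | IsOptDecomp g a ∧ ∑ j, a j ∈ levelSet B'}) ∩
      ⋂ j, {p | ‖p.1 j‖ • p.2 j = ‖p.2 j‖ • p.1 j} := by
    ext p
    simp only [rayPairs, mem_inter_iff, mem_prod, mem_iInter, mem_ofPred_eq,
      sameRay_iff_norm_smul_eq, and_assoc]
  rw [this]
  exact ((key hB).prod (key hB')).isClosed.inter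
    (isClosed_iInter fun j => isClosed_eq (by fun_prop) (by fun_prop))

/-- A continuous bijection from a compact space to a Hausdorff space. The first entry is recovered
as the optimal decomposition of its sum; the second is a rescaling of it, which exists and is unique
by the off-diagonal monotonicity. -/
theorem nonempty_rayPairs_homeomorph (hg : IsDecomposing g) (hB : IsAdmissible g B)
    (hB' : IsAdmissible g B') : Nonempty (rayPairs g B B' ≃ₜ levelSet B) := by
  have : CompactSpace (rayPairs g B B') :=
    isCompact_iff_compactSpace.1 (isCompact_rayPairs hg hB hB')
  let f : rayPairs g B B' → levelSet B := fun p => ⟨∑ j, p.1.1 j, p.2.1.2⟩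
  have hf : Continuous f := Continuous.subtype_mk (by fun_prop) _
  have hbij : Function.Bijective f := by
    constructor
    · rintro ⟨⟨a, b⟩, ⟨ha, haB⟩, ⟨hb, hbB⟩, hab⟩ ⟨⟨a', b'⟩, ⟨ha', haB'⟩, ⟨hb', hbB'⟩, hab'⟩ h
      have hsum : ∑ j, a j = ∑ j, a' j := congrArg Subtype.val h
      obtain rfl : a = a' := hg.isOptDecomp_unique ha ha' hsum
      have ha0 := hB.ne_zero ha.1 haB
      have hoff := hB'.isOffAntitone hg ha.1 ha0
      have hmul : ∀ {c : Fin r → Fin d → ℝ}, (∀ j, SameRay ℝ (a j) (c j)) →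
          ∃ t : Fin r → ℝ, 0 ≤ t ∧ ∀ j, c j = t j • a j := fun {c} hc => by
        choose t ht htc using fun j => (hc j).exists_nonneg_left (ha0 j)
        exact ⟨t, ht, fun j => (htc j).symm⟩
      obtain ⟨t, ht, htb⟩ := hmul hab
      obtain ⟨t', ht', htb'⟩ := hmul hab'
      obtain rfl : t = t' := hoff.unique ht ht'
        (fun i => by simpa only [← htb] using hbB i) (fun i => by simpa only [← htb'] using hbB' i)
      obtain rfl : b = b' := funext fun j => (htb j).trans (htb' j).symm
      rfl
    · rintro ⟨y, hy⟩
      obtain ⟨a, ha, rfl⟩ := hg.exists_isOptDecomp y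
      obtain ⟨t, ht, ht1⟩ := (hB'.isOffAntitone hg ha.1 (hB.ne_zero ha.1 hy)).exists_eq_one
      exact ⟨⟨⟨a, fun j => t j • a j⟩, ⟨ha, hy⟩, ⟨hg.isOptDecomp_smul ha ht, ht1⟩,
        fun j => SameRay.sameRay_nonneg_smul_right _ (ht j)⟩, rfl⟩
  exact ⟨Continuous.homeoOfEquivCompactToT2 (f := Equiv.ofBijective f hbij) hf⟩

/-- The topology of the level set does not depend on the choice of the admissible family. -/
theorem nonempty_levelSet_homeomorph (hg : IsDecomposing g) (hB : IsAdmissible g B)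
    (hB' : IsAdmissible g B') : Nonempty (levelSet B ≃ₜ levelSet B') := by
  obtain ⟨e⟩ := nonempty_rayPairs_homeomorph hg hB hB'
  obtain ⟨e'⟩ := nonempty_rayPairs_homeomorph hg hB' hB
  have hswap : Prod.swap '' rayPairs g B B' = rayPairs g B' B := by
    ext p
    constructor
    · rintro ⟨q, hq, rfl⟩
      exact ⟨hq.2.1, hq.1, fun j => (hq.2.2 j).symm⟩
    · exact fun hp => ⟨p.swap, ⟨hp.2.1, hp.1, fun j => (hp.2.2 j).symm⟩, p.swap_swap⟩
  exact ⟨e.symm.trans (((Homeomorph.prodComm _ _).image _).trans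
    ((Homeomorph.setCongr hswap).trans e'))⟩

end

/-! ### Circuits of linear forms and the model sphere. -/

/-- Linear forms whose only relations are the multiples of `∑ i, p i = 0`. -/
structure IsCircuit (p : Fin r → Fin d → ℝ) : Prop where
  sum_eq_zero : ∑ i, p i = 0
  const_of_rel : ∀ a : Fin r → ℝ, ∑ i, a i • p i = 0 → ∀ i j, a i = a j

/-- The linear map with components `⟨p i, ·⟩`. -/
def evalForms (p : Fin r → Fin d → ℝ) : (Fin d → ℝ) →ₗ[ℝ] (Fin r → ℝ) :=
  Matrix.mulVecLin (Matrix.of p)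

@[simp] theorem evalForms_apply (p : Fin r → Fin d → ℝ) (y : Fin d → ℝ) (i : Fin r) :
    evalForms p y i = p i ⬝ᵥ y := rfl

/-- The sum of the coordinates. -/
def coordSum (r : ℕ) : (Fin r → ℝ) →ₗ[ℝ] ℝ := ∑ i, LinearMap.proj i

@[simp] theorem coordSum_apply (t : Fin r → ℝ) : coordSum r t = ∑ i, t i := by
  simp [coordSum]

namespace IsCircuit

variable {p : Fin r → Fin d → ℝ}

theorem sum_dotProduct_eq_zero (hp : IsCircuit p) (y : Fin d → ℝ) : ∑ i, p i ⬝ᵥ y = 0 := by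
  rw [← sum_dotProduct, hp.sum_eq_zero, zero_dotProduct]

/-- A functional vanishing on the range has coefficients that form a relation among the `p i`. They
are therefore all equal, and the functional vanishes on vectors of coordinate sum zero. -/
theorem range_evalForms (hp : IsCircuit p) :
    LinearMap.range (evalForms p) = LinearMap.ker (coordSum r) := by
  apply le_antisymm
  · rintro _ ⟨y, rfl⟩
    simpa using hp.sum_dotProduct_eq_zero y
  · intro v hv
    by_contra hvr
    obtain ⟨f, hfv, hf⟩ := Submodule.exists_le_ker_of_notMem hvr
    have hfe : ∀ w : Fin r → ℝ, f w = ∑ i, w i * f (Pi.single i 1) := fun w => by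
      conv_lhs => rw [LinearMap.pi_apply_eq_sum_univ f w]
      refine Finset.sum_congr rfl fun i _ => ?_
      rw [smul_eq_mul]
      congr 2
      ext j
      simp [Pi.single_apply, eq_comm]
    have hrel : ∑ i, f (Pi.single i 1) • p i = 0 := by
      refine dotProduct_eq_zero _ fun y => ?_
      have h0 : f (evalForms p y) = 0 := hf ⟨y, rfl⟩
      rw [hfe] at h0
      rw [sum_dotProduct, ← h0]
      exact Finset.sum_congr rfl fun i _ => by
        rw [smul_dotProduct, smul_eq_mul, evalForms_apply, mul_comm]
    have hconst := hp.const_of_rel _ hrel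
    apply hfv
    rw [hfe]
    rcases isEmpty_or_nonempty (Fin r) with h | ⟨⟨k⟩⟩
    · simp
    · rw [Finset.sum_congr rfl fun i _ => by rw [hconst i k], ← Finset.sum_mul]
      have : ∑ i, v i = 0 := by simpa using hv
      rw [this, zero_mul]

theorem finrank_ker_evalForms (hp : IsCircuit p) (hr : 1 ≤ r) :
    Module.finrank ℝ (LinearMap.ker (evalForms p)) + r = d + 1 := by
  have h1 := LinearMap.finrank_range_add_finrank_ker (evalForms p)
  have h2 := LinearMap.finrank_range_add_finrank_ker (coordSum r)
  have h3 : LinearMap.range (coordSum r) = ⊤ := LinearMap.range_eq_top.2 fun c =>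
    ⟨Pi.single ⟨0, hr⟩ c, by simp⟩
  rw [hp.range_evalForms] at h1
  rw [h3, finrank_top] at h2
  simp at h1 h2
  omega

theorem exists_dual (hp : IsCircuit p) (hr : 1 ≤ r) : ∃ w : Fin r → Fin d → ℝ,
    ∀ i j, p i ⬝ᵥ w j = (Pi.single j 1 : Fin r → ℝ) i - (r : ℝ)⁻¹ := by
  have hr0 : (r : ℝ) ≠ 0 := by exact_mod_cast (Nat.one_le_iff_ne_zero.1 hr)
  have : ∀ j, ∃ w : Fin d → ℝ, evalForms p w = (Pi.single j 1 : Fin r → ℝ) - fun _ => (r : ℝ)⁻¹ :=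
    fun j => by
      rw [← LinearMap.mem_range, hp.range_evalForms, LinearMap.mem_ker, coordSum_apply]
      simp [hr0]
  choose w hw using this
  exact ⟨w, fun i j => congrFun (hw j) i⟩

end IsCircuit

/-- Solving `x + G x = u` is a fixed point problem for the contraction `x ↦ u - G x`. -/
theorem bijective_id_add_of_lipschitz {E : Type*} [NormedAddCommGroup E] [CompleteSpace E]
    {G : E → E} {K : ℝ} (hK0 : 0 ≤ K) (hK : K < 1) (hG : ∀ x y, ‖G x - G y‖ ≤ K * ‖x - y‖) :
    Function.Bijective fun x => x + G x := by
  constructor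
  · intro x y hxy
    have h : x - y = -(G x - G y) := by
      have : x + G x = y + G y := hxy
      rw [neg_sub, sub_eq_sub_iff_add_eq_add, add_comm (G y), this]
    have h1 := hG x y
    rw [← norm_neg (G x - G y), ← h] at h1
    have : ‖x - y‖ = 0 := by nlinarith [norm_nonneg (x - y)]
    exact sub_eq_zero.1 (norm_eq_zero.1 this)
  · intro u
    have hc : ContractingWith ⟨K, hK0⟩ fun x => u - G x := by
      refine ⟨by exact_mod_cast hK, LipschitzWith.of_dist_le_mul fun x y => ?_⟩
      rw [dist_eq_norm, dist_eq_norm, sub_sub_sub_cancel_left, norm_sub_rev]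
      exact hG x y
    have := hc.fixedPoint_isFixedPt
    exact ⟨_, by rw [Function.IsFixedPt] at this; exact eq_sub_iff_add_eq.1 this.symm⟩

section Twist

variable {g : Fin r → Set (Fin d → ℝ)} {p : Fin r → Fin d → ℝ}

/-- The sets `g i` translated by `S • p i`. -/
def twist (g : Fin r → Set (Fin d → ℝ)) (p : Fin r → Fin d → ℝ) (S : ℝ) (i : Fin r) :
    Set (Fin d → ℝ) :=
  (fun n => n + S • p i) '' g i

theorem supportFn_twist (hg : IsDecomposing g) (S : ℝ) (i : Fin r) (y : Fin d → ℝ) :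
    supportFn (twist g p S i) y = supportFn (g i) y + S * (p i ⬝ᵥ y) := by
  apply le_antisymm
  · refine supportFn_le ((hg.nonempty i).image _) (forall_mem_image.2 fun n hn => ?_)
    rw [add_dotProduct, smul_dotProduct, smul_eq_mul]
    exact add_le_add_left (le_supportFn (hg.finite i) hn y) _
  · obtain ⟨n, hn, hny⟩ := exists_eq_supportFn (hg.finite i) (hg.nonempty i) y
    rw [← hny, ← smul_eq_mul, ← smul_dotProduct, ← add_dotProduct]
    exact le_supportFn (B := twist g p S i) ((hg.finite i).image _) ⟨n, hn, rfl⟩ y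

theorem isAdmissible_twist (hg : IsDecomposing g) (hp : IsCircuit p)
    (hpg : ∀ i x, supportFn (g i) x ≤ 0 → p i ⬝ᵥ x ≤ 0) {S : ℝ} (hS : 0 ≤ S) :
    IsAdmissible g (twist g p S) where
  finite i := (hg.finite i).image _
  nonempty i := (hg.nonempty i).image _
  nonpos i := forall_mem_image.2 fun n hn x hx => by
    rw [add_dotProduct, smul_dotProduct, smul_eq_mul]
    linarith [le_supportFn (hg.finite i) hn x, mul_nonpos_of_nonneg_of_nonpos hS (hpg i x hx)]
  pos x hx := by
    by_contra! h
    simp only [supportFn_twist hg] at h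
    obtain ⟨i, hi⟩ := hg.pos x hx
    -- The twists cancel in the sum over `i`, leaving the untwisted support functions.
    have h1 : ∑ i, (supportFn (g i) x + S * (p i ⬝ᵥ x)) ≤ 0 := Finset.sum_nonpos fun i _ => h i
    rw [Finset.sum_add_distrib, ← Finset.mul_sum, hp.sum_dotProduct_eq_zero, mul_zero,
      add_zero] at h1
    linarith [Finset.single_le_sum (f := fun i => supportFn (g i) x)
      (fun i _ => hg.nonneg i x) (Finset.mem_univ i)]

/-- With `⟨p i, w j⟩ = δ_ij - 1/r`, the map `H y = y + S⁻¹ ∑ supportFn (g j) y • w j` satisfies `⟨p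
i, H y⟩ = S⁻¹ (supportFn (twist g p S i) y - η)`, where `η` is the mean of the untwisted,
equivalently of the twisted, values at `y`. So `H y` lies in the common kernel of the `p i` exactly
when all twisted values agree. Since `H` is a homogeneous bijection, rays of the kernel correspond
to points of the level set. -/
theorem exists_levelSet_twist_homeomorph_sphere (hr : 1 ≤ r) (hg : IsDecomposing g)
    (hp : IsCircuit p) (hpg : ∀ i x, supportFn (g i) x ≤ 0 → p i ⬝ᵥ x ≤ 0) :
    ∃ S : ℝ, 0 ≤ S ∧ Nonempty (levelSet (twist g p S) ≃ₜ
      Metric.sphere (0 : EuclideanSpace ℝ (Fin (d + 1 - r))) 1) := by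
  obtain ⟨w, hw⟩ := hp.exists_dual hr
  have hr0 : (r : ℝ) ≠ 0 := by exact_mod_cast (Nat.one_le_iff_ne_zero.1 hr)
  choose C hC0 hC using fun i => exists_lipschitz_supportFn (hg.finite i) (hg.nonempty i)
  set K : ℝ := ∑ j, C j * ‖w j‖ with hKdef
  have hK0 : 0 ≤ K := Finset.sum_nonneg fun j _ => mul_nonneg (hC0 j) (norm_nonneg _)
  -- Makes `S⁻¹ K < 1`, so that the perturbation `G` is a contraction.
  set S : ℝ := K + 1
  have hS : 0 < S := by positivity
  refine ⟨S, hS.le, ?_⟩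
  let G : (Fin d → ℝ) → Fin d → ℝ := fun y => S⁻¹ • ∑ j, supportFn (g j) y • w j
  let H : (Fin d → ℝ) → Fin d → ℝ := fun y => y + G y
  have hGlip : ∀ x y, ‖G x - G y‖ ≤ S⁻¹ * K * ‖x - y‖ := fun x y => by
    simp only [G]
    rw [← smul_sub, norm_smul, Real.norm_eq_abs, abs_of_pos (inv_pos.2 hS), mul_assoc,
      ← Finset.sum_sub_distrib, hKdef, Finset.sum_mul]
    refine mul_le_mul_of_nonneg_left ((norm_sum_le _ _).trans (Finset.sum_le_sum fun j _ => ?_))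
      (inv_pos.2 hS).le
    rw [← sub_smul, norm_smul, mul_right_comm]
    exact mul_le_mul_of_nonneg_right (hC j x y) (norm_nonneg _)
  have hH : Function.Bijective H := bijective_id_add_of_lipschitz
    (mul_nonneg (inv_pos.2 hS).le hK0)
    (by rw [inv_mul_lt_one₀ hS]; exact lt_add_one K) hGlip
  have hHc : Continuous H := by
    have := fun j => continuous_supportFn (hg.finite j) (hg.nonempty j)
    fun_prop
  have hHsmul : ∀ c : ℝ, 0 ≤ c → ∀ y, H (c • y) = c • H y := fun c hc y => by
    simp only [H, G, supportFn_smul (hg.finite _) (hg.nonempty _) hc, smul_add, mul_smul,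
      ← Finset.smul_sum]
    rw [smul_comm S⁻¹ c]
  have hH0 : H 0 = 0 := by simpa using hHsmul 0 le_rfl 0
  have hpH : ∀ i y, p i ⬝ᵥ H y = S⁻¹ * (supportFn (twist g p S i) y
      - (r : ℝ)⁻¹ * ∑ j, supportFn (g j) y) := fun i y => by
    simp only [H, G, dotProduct_add, dotProduct_smul, dotProduct_sum, smul_eq_mul, hw,
      supportFn_twist hg, mul_sub, Finset.sum_sub_distrib, ← Finset.sum_mul]
    rw [Finset.sum_eq_single i (fun j _ hj => by simp [hj.symm]) (by simp)]
    simp only [Pi.single_eq_same]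
    field_simp
    ring
  have hmem : ∀ y ∈ levelSet (twist g p S), H y ∈ LinearMap.ker (evalForms p) := fun y hy => by
    ext i
    have h1 : ∑ j, supportFn (g j) y = r := by
      have : ∑ j, supportFn (twist g p S j) y = r :=
        (Finset.sum_congr rfl fun j _ => hy j).trans (by simp)
      simpa [supportFn_twist hg, Finset.sum_add_distrib, ← Finset.mul_sum,
        hp.sum_dotProduct_eq_zero] using this
    rw [evalForms_apply, hpH, hy i, h1]
    simp [hr0]
  have hadm := isAdmissible_twist hg hp hpg hS.le
  have hne : ∀ y ∈ levelSet (twist g p S), H y ≠ 0 := fun y hy h0 => by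
    have hy0 : y = 0 := hH.1 (h0.trans hH0.symm)
    have := hy ⟨0, hr⟩
    rw [hy0, supportFn_zero (hadm.nonempty _)] at this
    exact zero_ne_one this
  have hrank := hp.finrank_ker_evalForms hr
  let e : LinearMap.ker (evalForms p) ≃L[ℝ] EuclideanSpace ℝ (Fin (d + 1 - r)) :=
    ContinuousLinearEquiv.ofFinrankEq (by rw [finrank_euclideanSpace_fin]; omega)
  let h : levelSet (twist g p S) → EuclideanSpace ℝ (Fin (d + 1 - r)) :=
    fun y => e ⟨H y, hmem y y.2⟩
  have hhc : Continuous h := e.continuous.comp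
    (Continuous.subtype_mk (hHc.comp continuous_subtype_val) _)
  have hh0 : ∀ y, h y ≠ 0 := fun y h0 => hne y y.2 <| by
    have := e.map_eq_zero_iff.1 h0
    exact congrArg Subtype.val this
  let f : levelSet (twist g p S) → Metric.sphere (0 : EuclideanSpace ℝ (Fin (d + 1 - r))) 1 :=
    fun y => ⟨‖h y‖⁻¹ • h y, by simp [norm_smul, hh0 y]⟩
  have hf : Continuous f :=
    Continuous.subtype_mk ((hhc.norm.inv₀ fun y => norm_ne_zero_iff.2 (hh0 y)).smul hhc) _
  have hbij : Function.Bijective f := by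
    constructor
    · rintro ⟨y, hy⟩ ⟨z, hz⟩ hyz
      have h1 : ‖h ⟨y, hy⟩‖⁻¹ • h ⟨y, hy⟩ = ‖h ⟨z, hz⟩‖⁻¹ • h ⟨z, hz⟩ := congrArg Subtype.val hyz
      simp only [h, ← map_smul] at h1
      have h2 := congrArg Subtype.val (e.injective h1)
      simp only [Submodule.coe_smul] at h2
      rw [← hHsmul _ (by positivity), ← hHsmul _ (by positivity)] at h2
      have h3 := hH.1 h2
      have h4 := congrArg (supportFn (twist g p S ⟨0, hr⟩)) h3
      rw [supportFn_smul (hadm.finite _) (hadm.nonempty _) (by positivity),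
        supportFn_smul (hadm.finite _) (hadm.nonempty _) (by positivity), hy, hz, mul_one,
        mul_one] at h4
      rw [← h4] at h3
      have h5 := hh0 ⟨y, hy⟩
      exact Subtype.ext (smul_right_injective _ (inv_ne_zero (norm_ne_zero_iff.2 h5)) h3)
    · rintro ⟨u, hu⟩
      have hu0 : u ≠ 0 := by rintro rfl; simp at hu
      obtain ⟨y, hy⟩ := hH.2 (e.symm u : Fin d → ℝ)
      have hker : ∀ i, p i ⬝ᵥ H y = 0 := fun i => by
        rw [hy]
        exact congrFun (LinearMap.mem_ker.1 (e.symm u).2) i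
      -- The common value of the twisted support functions at `y`; it is positive by admissibility,
      -- so dividing by it reaches level `1`.
      set η : ℝ := (r : ℝ)⁻¹ * ∑ j, supportFn (g j) y
      have hη : ∀ i, supportFn (twist g p S i) y = η := fun i => by
        have := hker i
        rw [hpH] at this
        exact sub_eq_zero.1 ((mul_eq_zero.1 this).resolve_left (inv_ne_zero hS.ne'))
      have hy0 : y ≠ 0 := by
        rintro rfl
        rw [hH0] at hy
        exact hu0 (e.symm.map_eq_zero_iff.1 (Subtype.ext hy.symm))
      have hηpos : 0 < η := by
        obtain ⟨i, hi⟩ := hadm.pos y hy0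
        rwa [hη] at hi
      have hyM : η⁻¹ • y ∈ levelSet (twist g p S) := fun i => by
        rw [supportFn_smul (hadm.finite _) (hadm.nonempty _) (inv_pos.2 hηpos).le, hη,
          inv_mul_cancel₀ hηpos.ne']
      refine ⟨⟨_, hyM⟩, Subtype.ext ?_⟩
      have hhy : h ⟨_, hyM⟩ = η⁻¹ • u := by
        simp only [h]
        rw [← e.apply_symm_apply u, ← map_smul]
        congr 1
        refine Subtype.ext ?_
        change H (η⁻¹ • y) = η⁻¹ • (e.symm u : Fin d → ℝ)
        rw [hHsmul _ (inv_pos.2 hηpos).le, hy]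
      have hu1 : ‖u‖ = 1 := by simpa using hu
      simp only [f]
      rw [hhy, norm_smul, hu1, mul_one, norm_inv, inv_inv, Real.norm_eq_abs, abs_of_pos hηpos,
        smul_smul, mul_inv_cancel₀ hηpos.ne', one_smul]
  have : CompactSpace (levelSet (twist g p S)) :=
    isCompact_iff_compactSpace.1 hadm.isCompact_levelSet
  exact ⟨Continuous.homeoOfEquivCompactToT2 (f := Equiv.ofBijective f hbij) hf⟩

/-- The common level set of an admissible family is a sphere. -/
theorem nonempty_levelSet_homeomorph_sphere (hr : 1 ≤ r) (hg : IsDecomposing g)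
    (hp : IsCircuit p) (hpg : ∀ i x, supportFn (g i) x ≤ 0 → p i ⬝ᵥ x ≤ 0)
    {B : Fin r → Set (Fin d → ℝ)} (hB : IsAdmissible g B) :
    Nonempty (levelSet B ≃ₜ Metric.sphere (0 : EuclideanSpace ℝ (Fin (d + 1 - r))) 1) := by
  obtain ⟨S, hS, ⟨e⟩⟩ := exists_levelSet_twist_homeomorph_sphere hr hg hp hpg
  obtain ⟨e'⟩ := nonempty_levelSet_homeomorph hg hB (isAdmissible_twist hg hp hpg hS)
  exact ⟨e'.trans e⟩

end Twist

/-! ### Decompositions from a nef-partition. -/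

/-- Integral generators `g i` of the summands of a nef-partition, and integral generators `T` of
the dual of the Minkowski sum. -/
structure IsNefData (g : Fin r → Set (Fin d → ℝ)) (T : Finset (Fin d → ℝ)) : Prop where
  one_le : 1 ≤ r
  finite : ∀ i, (g i).Finite
  nonempty : ∀ i, (g i).Nonempty
  integral : ∀ i, ∀ n ∈ g i, ∃ m, n = intVec m
  zero_mem : ∀ i, 0 ∈ convexHull ℝ (g i)
  zero_mem_interior : 0 ∈ interior (∑ i, convexHull ℝ (g i))
  dual_eq : dualPolytope (∑ i, convexHull ℝ (g i)) = convexHull ℝ (T : Set (Fin d → ℝ))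
  integral_dual : ∀ v ∈ T, ∃ m, v = intVec m

theorem IsNefPartition.exists_data (hr : 1 ≤ r) {Δ : Fin r → Set (Fin d → ℝ)}
    (hΔ : IsNefPartition Δ) : ∃ g T, IsNefData g T ∧ Δ = fun i => convexHull ℝ (g i) := by
  classical
  choose s hs hsΔ using hΔ.latticePolytope
  obtain ⟨-, h0, u, -, hu⟩ := hΔ.reflexive
  obtain rfl : Δ = fun i => convexHull ℝ (intVec '' (s i : Set (Fin d → ℤ))) := funext hsΔ
  refine ⟨fun i => intVec '' (s i : Set (Fin d → ℤ)), u.image intVec, ⟨hr, fun i => ?_, fun i => ?_,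
    fun i => ?_, hΔ.zero_mem, h0, ?_, ?_⟩, rfl⟩
  · exact (s i).finite_toSet.image _
  · exact (Finset.coe_nonempty.2 (hs i)).image _
  · rintro _ ⟨m, -, rfl⟩
    exact ⟨m, rfl⟩
  · rw [Finset.coe_image]
    exact hu
  · intro v hv
    obtain ⟨m, -, rfl⟩ := Finset.mem_image.1 hv
    exact ⟨m, rfl⟩

theorem intVec_dotProduct (m n : Fin d → ℤ) :
    intVec m ⬝ᵥ intVec n = ((m ⬝ᵥ n : ℤ) : ℝ) := by
  simp [dotProduct, intVec]

theorem sum_smul_mem_of_sum_le_one {E ι : Type*} [AddCommGroup E] [Module ℝ E] {s : Set E}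
    (hs : Convex ℝ s) (h0 : 0 ∈ s) {t : Finset ι} {w : ι → ℝ} {f : ι → E}
    (hw : ∀ i ∈ t, 0 ≤ w i) (hw1 : ∑ i ∈ t, w i ≤ 1) (hf : ∀ i ∈ t, f i ∈ s) :
    ∑ i ∈ t, w i • f i ∈ s := by
  rcases (Finset.sum_nonneg hw).eq_or_lt with h | h
  · rw [Finset.sum_eq_zero fun i hi => by
      rw [(Finset.sum_eq_zero_iff_of_nonneg hw).1 h.symm i hi, zero_smul]]
    exact h0
  · have h1 : ∑ i ∈ t, (w i / ∑ j ∈ t, w j) • f i ∈ s :=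
      hs.sum_mem (fun i hi => div_nonneg (hw i hi) h.le)
        (by rw [← Finset.sum_div, div_self h.ne']) hf
    have h2 := hs.smul_mem_of_zero_mem h0 h1 ⟨h.le, hw1⟩
    rwa [Finset.smul_sum, Finset.sum_congr rfl fun i _ => by
      rw [smul_smul, mul_div_cancel₀ _ h.ne']] at h2

namespace IsNefData

variable {g : Fin r → Set (Fin d → ℝ)} {T : Finset (Fin d → ℝ)}

theorem nonneg (hg : IsNefData g T) (i : Fin r) (x : Fin d → ℝ) : 0 ≤ supportFn (g i) x := by
  simpa using dotProduct_le_of_mem_convexHull (fun b hb => le_supportFn (hg.finite i) hb x)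
    (hg.zero_mem i)

theorem dotProduct_le_sum (hg : IsNefData g T) {y : Fin d → ℝ}
    (hy : y ∈ ∑ i, convexHull ℝ (g i)) (x : Fin d → ℝ) : y ⬝ᵥ x ≤ ∑ i, supportFn (g i) x := by
  obtain ⟨f, hf, rfl⟩ := (mem_fintype_sum _ _).1 hy
  rw [sum_dotProduct]
  exact Finset.sum_le_sum fun i _ =>
    dotProduct_le_of_mem_convexHull (fun b hb => le_supportFn (hg.finite i) hb x) (hf i)

theorem mem_dual_iff (hg : IsNefData g T) (x : Fin d → ℝ) :
    x ∈ dualPolytope (∑ i, convexHull ℝ (g i)) ↔ ∑ i, supportFn (g i) x ≤ 1 := by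
  refine ⟨fun hx => ?_, fun hx y hy => (hg.dotProduct_le_sum hy x).trans hx⟩
  choose n hn hnx using fun i => exists_eq_supportFn (hg.finite i) (hg.nonempty i) x
  have := hx (∑ i, n i)
    ((mem_fintype_sum _ _).2 ⟨n, fun i => subset_convexHull ℝ _ (hn i), rfl⟩)
  rw [sum_dotProduct] at this
  simpa only [hnx] using this

theorem exists_smul_mem (hg : IsNefData g T) (x : Fin d → ℝ) :
    ∃ δ : ℝ, 0 < δ ∧ δ • x ∈ ∑ i, convexHull ℝ (g i) := by
  have hc : Continuous fun δ : ℝ => δ • x := by fun_prop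
  have hev : ∀ᶠ δ in 𝓝[>] (0 : ℝ), δ • x ∈ ∑ i, convexHull ℝ (g i) :=
    nhdsWithin_le_nhds (hc.continuousAt.eventually_mem
      (by rw [zero_smul]; exact mem_interior_iff_mem_nhds.1 hg.zero_mem_interior))
  obtain ⟨δ, hδ, hδ0⟩ := (hev.and self_mem_nhdsWithin).exists
  exact ⟨δ, hδ0, hδ⟩

theorem pos (hg : IsNefData g T) (x : Fin d → ℝ) (hx : x ≠ 0) : ∃ i, 0 < supportFn (g i) x := by
  by_contra! h
  obtain ⟨δ, hδ, hδx⟩ := hg.exists_smul_mem x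
  have h1 := (hg.dotProduct_le_sum hδx x).trans (Finset.sum_nonpos fun i _ => h i)
  rw [smul_dotProduct, smul_eq_mul] at h1
  have h2 : 0 ≤ x ⬝ᵥ x := Finset.sum_nonneg fun k _ => mul_self_nonneg (x k)
  have h3 : x ⬝ᵥ x = 0 := by nlinarith
  exact hx (dotProduct_self_eq_zero.1 h3)

theorem sum_pos (hg : IsNefData g T) (x : Fin d → ℝ) (hx : x ≠ 0) :
    0 < ∑ i, supportFn (g i) x := by
  obtain ⟨i, hi⟩ := hg.pos x hx
  exact Finset.sum_pos' (fun i _ => hg.nonneg i x) ⟨i, Finset.mem_univ i, hi⟩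

theorem exists_int_supportFn (hg : IsNefData g T) {v : Fin d → ℝ} (hv : v ∈ T) (i : Fin r) :
    ∃ k : ℤ, supportFn (g i) v = k := by
  obtain ⟨n, hn, hnv⟩ := exists_eq_supportFn (hg.finite i) (hg.nonempty i) v
  obtain ⟨m, rfl⟩ := hg.integral i n hn
  obtain ⟨z, rfl⟩ := hg.integral_dual v hv
  exact ⟨_, by rw [← hnv, intVec_dotProduct]⟩

/-- Integrality of the dual polytope enters here: the values of the support functions at `v` are
nonnegative integers with sum at most `1`, and they are not all zero. -/
theorem exists_index (hg : IsNefData g T) {v : Fin d → ℝ} (hv : v ∈ T) (hv0 : v ≠ 0) :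
    ∃ j, supportFn (g j) v = 1 ∧ ∀ i, i ≠ j → supportFn (g i) v = 0 := by
  have hle : ∑ i, supportFn (g i) v ≤ 1 := (hg.mem_dual_iff v).1 (by
    rw [hg.dual_eq]
    exact subset_convexHull ℝ _ hv)
  choose k hk using hg.exists_int_supportFn hv
  obtain ⟨j, hj⟩ := hg.pos v hv0
  have hkj : 1 ≤ k j := by
    rw [hk] at hj
    exact_mod_cast hj
  have h1 : (1 : ℝ) ≤ supportFn (g j) v := by rw [hk]; exact_mod_cast hkj
  rw [← Finset.add_sum_erase _ _ (Finset.mem_univ j)] at hle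
  have h2 : 0 ≤ ∑ i ∈ Finset.univ.erase j, supportFn (g i) v :=
    Finset.sum_nonneg fun i _ => hg.nonneg i v
  refine ⟨j, by linarith, fun i hi => ?_⟩
  exact (Finset.sum_eq_zero_iff_of_nonneg fun i _ => hg.nonneg i v).1
    (show ∑ i ∈ Finset.univ.erase j, supportFn (g i) v = 0 by linarith) i
    (Finset.mem_erase.2 ⟨hi, Finset.mem_univ i⟩)

open Classical in
/-- The generators of the dual polytope on which the support function of `g j` is `1`. -/
noncomputable def face (g : Fin r → Set (Fin d → ℝ)) (T : Finset (Fin d → ℝ)) (j : Fin r) :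
    Finset (Fin d → ℝ) :=
  T.filter fun v => supportFn (g j) v = 1

theorem mem_face {v : Fin d → ℝ} {j : Fin r} : v ∈ face g T j ↔ v ∈ T ∧ supportFn (g j) v = 1 := by
  simp [face]

theorem supportFn_of_mem_face (hg : IsNefData g T) {v : Fin d → ℝ} {j : Fin r}
    (hv : v ∈ face g T j) {i : Fin r} (hij : i ≠ j) : supportFn (g i) v = 0 := by
  obtain ⟨hvT, hvj⟩ := mem_face.1 hv
  have hv0 : v ≠ 0 := by
    rintro rfl
    rw [supportFn_zero (hg.nonempty j)] at hvj
    exact zero_ne_one hvj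
  obtain ⟨k, hk, hk'⟩ := hg.exists_index hvT hv0
  obtain rfl : j = k := by
    by_contra hjk
    rw [hk' j hjk] at hvj
    exact zero_ne_one hvj
  exact hk' i hij

theorem sum_face (hg : IsNefData g T) {M : Type*} [AddCommMonoid M] (f : (Fin d → ℝ) → M)
    (h0 : f 0 = 0) : ∑ j, ∑ v ∈ face g T j, f v = ∑ v ∈ T, f v := by
  classical
  simp only [face, Finset.sum_filter]
  rw [Finset.sum_comm]
  refine Finset.sum_congr rfl fun v hv => ?_
  rcases eq_or_ne v 0 with rfl | hv0
  · simp [h0]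
  · obtain ⟨j, hj, hj'⟩ := hg.exists_index hv hv0
    rw [Finset.sum_eq_single j (fun i _ hi => by simp [hj' i hi]) (by simp), if_pos hj]

theorem supportFn_sum_face_le (hg : IsNefData g T) {w : (Fin d → ℝ) → ℝ} (hw : ∀ v ∈ T, 0 ≤ w v)
    (i j : Fin r) : supportFn (g i) (∑ v ∈ face g T j, w v • v) ≤
      if i = j then ∑ v ∈ face g T j, w v else 0 := by
  refine (supportFn_sum_le (hg.finite i) (hg.nonempty i) _ _).trans (le_of_eq ?_)
  have h1 : ∀ v ∈ face g T j, supportFn (g i) (w v • v) = w v * supportFn (g i) v := fun v hv =>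
    supportFn_smul (hg.finite i) (hg.nonempty i) (hw v (mem_face.1 hv).1) v
  rw [Finset.sum_congr rfl h1]
  split_ifs with hij
  · subst hij
    exact Finset.sum_congr rfl fun v hv => by rw [(mem_face.1 hv).2, mul_one]
  · exact Finset.sum_eq_zero fun v hv => by rw [hg.supportFn_of_mem_face hv hij, mul_zero]

/-- Divide `y` by `c = ∑ supportFn (g i) y` to land in the dual polytope, expand in `T`, and group
by faces. The mass on face `j` is at least `supportFn (g j) y`, while the total mass is at most `c`,
so equality holds for each `j`. -/
theorem exists_weights (hg : IsNefData g T) (y : Fin d → ℝ) : ∃ w : (Fin d → ℝ) → ℝ,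
    (∀ v ∈ T, 0 ≤ w v) ∧ (∀ j, ∑ v ∈ face g T j, w v = supportFn (g j) y) ∧
    ∑ j, ∑ v ∈ face g T j, w v • v = y := by
  rcases eq_or_ne y 0 with rfl | hy
  · exact ⟨0, by simp, by simp [supportFn_zero (hg.nonempty _)], by simp⟩
  set c := ∑ i, supportFn (g i) y with hcdef
  have hc : 0 < c := hg.sum_pos y hy
  have hmem : c⁻¹ • y ∈ convexHull ℝ (T : Set (Fin d → ℝ)) := by
    rw [← hg.dual_eq, hg.mem_dual_iff]
    simp only [supportFn_smul (hg.finite _) (hg.nonempty _) (inv_pos.2 hc).le]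
    rw [← Finset.mul_sum, ← hcdef, inv_mul_cancel₀ hc.ne']
  obtain ⟨w, hw0, hw1, hwy⟩ := Finset.mem_convexHull'.1 hmem
  have hw0' : ∀ v ∈ T, 0 ≤ c * w v := fun v hv => mul_nonneg hc.le (hw0 v hv)
  have hsum : ∑ j, ∑ v ∈ face g T j, (c * w v) • v = y := by
    rw [hg.sum_face (fun v => (c * w v) • v) (by simp)]
    simp only [mul_smul]
    rw [← Finset.smul_sum, hwy, smul_smul, mul_inv_cancel₀ hc.ne', one_smul]
  have hge : ∀ j, supportFn (g j) y ≤ ∑ v ∈ face g T j, c * w v := fun j => by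
    conv_lhs => rw [← hsum]
    refine (supportFn_sum_le (hg.finite j) (hg.nonempty j) _ _).trans ?_
    refine (Finset.sum_le_sum fun k _ => hg.supportFn_sum_face_le hw0' j k).trans ?_
    simp
  have hle : ∑ j, ∑ v ∈ face g T j, c * w v ≤ ∑ j, supportFn (g j) y := by
    rw [← hcdef]
    have h1 : ∑ j, ∑ v ∈ face g T j, c * w v ≤ ∑ v ∈ T, c * w v := by
      classical
      rw [← Finset.sum_biUnion fun j _ k _ hjk => ?_]
      · refine Finset.sum_le_sum_of_subset_of_nonneg ?_ fun v hv _ => hw0' v hv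
        exact Finset.biUnion_subset.2 fun j _ v hv => (mem_face.1 hv).1
      · refine Finset.disjoint_left.2 fun v hv hv' => ?_
        have h := (mem_face.1 hv).2
        rw [hg.supportFn_of_mem_face hv' hjk] at h
        exact zero_ne_one h
    rwa [← Finset.mul_sum, hw1, mul_one] at h1
  have heq := (Finset.sum_eq_sum_iff_of_le fun j _ => hge j).1
    ((Finset.sum_le_sum fun j _ => hge j).antisymm hle)
  exact ⟨fun v => c * w v, hw0', fun j => (heq j (Finset.mem_univ j)).symm, hsum⟩

theorem isDecomposing (hg : IsNefData g T) : IsDecomposing g where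
  finite := hg.finite
  nonempty := hg.nonempty
  nonneg := hg.nonneg
  pos := hg.pos
  exists_decomp y := by
    obtain ⟨w, hw0, hw, hwy⟩ := hg.exists_weights y
    refine ⟨fun j => ∑ v ∈ face g T j, w v • v, ⟨fun i j hij => ?_, fun j => ?_⟩, hwy⟩
    · simpa [hij] using hg.supportFn_sum_face_le hw0 i j
    · rw [hwy, ← hw j]
      simpa using hg.supportFn_sum_face_le hw0 j j

theorem dotProduct_le_of_face (hg : IsNefData g T) {m : Fin d → ℝ} {κ : Fin r → ℝ}
    (h : ∀ j, ∀ v ∈ face g T j, m ⬝ᵥ v ≤ κ j) (y : Fin d → ℝ) :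
    m ⬝ᵥ y ≤ ∑ j, κ j * supportFn (g j) y := by
  obtain ⟨w, hw0, hw, hwy⟩ := hg.exists_weights y
  conv_lhs => rw [← hwy]
  simp only [← hw, dotProduct_sum, dotProduct_smul, smul_eq_mul, Finset.mul_sum]
  refine Finset.sum_le_sum fun j _ => Finset.sum_le_sum fun v hv => ?_
  rw [mul_comm (κ j)]
  exact mul_le_mul_of_nonneg_left (h j v hv) (hw0 v (mem_face.1 hv).1)

end IsNefData

/-! ### The circuit obtained from irreducibility. -/

/-- The combination map is open onto its range, which contains the affine span of the sum. Small
positive coefficients form an open set mapped into the sum, and a small multiple of the positive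
relation `β` lies in it and maps to `0`. -/
theorem zero_mem_intrinsicInterior_sum {ι E : Type*} [Fintype ι] [NormedAddCommGroup E]
    [NormedSpace ℝ E] [FiniteDimensional ℝ E] {g : ι → Set E} [∀ i, Fintype (g i)]
    (h0 : ∀ i, 0 ∈ convexHull ℝ (g i)) {β : (Σ i, g i) → ℝ} (hβ : ∀ j, 0 < β j)
    (hsum : ∑ j, β j • (j.2 : E) = 0) :
    (0 : E) ∈ intrinsicInterior ℝ (∑ i, convexHull ℝ (g i)) := by
  set C : Set E := ∑ i, convexHull ℝ (g i)
  let l : ((Σ i, g i) → ℝ) →ₗ[ℝ] E := Fintype.linearCombination ℝ fun j => (j.2 : E)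
  have hl : ∀ b, l b = ∑ j, b j • (j.2 : E) := fun b => Fintype.linearCombination_apply ℝ _ b
  have hopen : IsOpenMap l.rangeRestrict :=
    LinearMap.isOpenMap_of_finiteDimensional _ l.surjective_rangeRestrict
  let U : Set ((Σ i, g i) → ℝ) := {b | (∀ j, 0 < b j) ∧ ∑ j, b j < 1}
  have hU : IsOpen U := by
    simp only [U, ofPred_and, ofPred_forall]
    exact (isOpen_iInter_of_finite fun j => isOpen_lt continuous_const (continuous_apply j)).inter
      (isOpen_lt (by fun_prop) continuous_const)
  have hUC : ∀ b ∈ U, l b ∈ C := fun b hb => by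
    refine (mem_fintype_sum _ _).2 ⟨fun i => ∑ n : g i, b ⟨i, n⟩ • (n : E), fun i => ?_, ?_⟩
    · refine sum_smul_mem_of_sum_le_one (convex_convexHull ℝ _) (h0 i)
        (fun n _ => (hb.1 _).le) ?_ fun n _ => subset_convexHull ℝ _ n.2
      refine le_trans ?_ hb.2.le
      rw [Fintype.sum_sigma]
      exact Finset.single_le_sum (f := fun i => ∑ n : g i, b ⟨i, n⟩)
        (fun i _ => Finset.sum_nonneg fun n _ => (hb.1 _).le) (Finset.mem_univ i)
    · rw [hl, Fintype.sum_sigma]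
  obtain ⟨O, hO, hOU⟩ := isOpen_induced_iff.1 (hopen U hU)
  have h0O : (0 : E) ∈ O := by
    have hs : 0 ≤ ∑ j, β j := Finset.sum_nonneg fun j _ => (hβ j).le
    set c : ℝ := (1 + ∑ j, β j)⁻¹
    have hc : 0 < c := by positivity
    have hmem : c • β ∈ U := by
      refine ⟨fun j => mul_pos hc (hβ j), ?_⟩
      simp only [Pi.smul_apply, smul_eq_mul]
      rw [← Finset.mul_sum, inv_mul_lt_one₀ (by positivity)]
      linarith
    have h1 : l.rangeRestrict (c • β) = 0 := by
      refine Subtype.ext ?_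
      change l (c • β) = 0
      rw [map_smul, hl, hsum, smul_zero]
    have h2 : (0 : LinearMap.range l) ∈ l.rangeRestrict '' U := ⟨_, hmem, h1⟩
    rw [← hOU] at h2
    exact h2
  have hCW : C ⊆ LinearMap.range l := by
    intro x hx
    obtain ⟨f, hf, rfl⟩ := (mem_fintype_sum _ _).1 hx
    refine Submodule.sum_mem _ fun i _ => ?_
    refine convexHull_min (t := (LinearMap.range l : Set E)) (fun n hn => ?_)
      (LinearMap.range l).convex (hf i)
    classical
    exact ⟨Pi.single ⟨i, n, hn⟩ 1, by simp [l]⟩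
  have hspan : affineSpan ℝ C ≤ (LinearMap.range l).toAffineSubspace := affineSpan_le.2 hCW
  have h0C : (0 : E) ∈ C := (mem_fintype_sum _ _).2 ⟨0, h0, by simp⟩
  refine mem_intrinsicInterior.2 ⟨⟨0, subset_affineSpan ℝ C h0C⟩, ?_, rfl⟩
  refine mem_interior.2 ⟨Subtype.val ⁻¹' O, ?_, hO.preimage continuous_subtype_val, h0O⟩
  rintro ⟨x, hx⟩ hxO
  have hxW : x ∈ LinearMap.range l := hspan hx
  have h3 : (⟨x, hxW⟩ : LinearMap.range l) ∈ l.rangeRestrict '' U := by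
    rw [← hOU]
    exact hxO
  obtain ⟨b, hb, hbx⟩ := h3
  have : l b = x := congrArg Subtype.val hbx
  change x ∈ C
  rw [← this]
  exact hUC b hb

namespace IsNefData

variable {g : Fin r → Set (Fin d → ℝ)} {T : Finset (Fin d → ℝ)}

/-- Take `p i` to be a combination of all generators in `g i` with positive coefficients, arranged
so that `∑ p i = 0`. From a nonconstant relation subtract the minimal coefficient: what remains is a
relation with positive weights on the generators of a nonempty proper subset of the summands,
against irreducibility. -/
theorem exists_circuit (hg : IsNefData g T) (hirr : IsIrreducible fun i => convexHull ℝ (g i)) :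
    ∃ p : Fin r → Fin d → ℝ, IsCircuit p ∧
      ∀ i x, supportFn (g i) x ≤ 0 → p i ⬝ᵥ x ≤ 0 := by
  have : ∀ i, Fintype (g i) := fun i => (hg.finite i).fintype
  -- Writing `-δ` times the sum of all generators as `∑ q i` with `q i` in the summands makes the
  -- coefficients `w i n + δ` positive and the total zero.
  obtain ⟨δ, hδ, hδm⟩ := hg.exists_smul_mem (-∑ i, ∑ n : g i, (n : Fin d → ℝ))
  obtain ⟨q, hq, hqsum⟩ := (mem_fintype_sum _ _).1 hδm
  have hw : ∀ i, ∃ w : g i → ℝ, (∀ n, 0 ≤ w n) ∧ ∑ n, w n • (n : Fin d → ℝ) = q i := fun i => by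
    have h1 := hq i
    rw [← (hg.finite i).coe_toFinset] at h1
    obtain ⟨w, hw0, -, hw⟩ := Finset.mem_convexHull'.1 h1
    refine ⟨fun n => w n, fun n => hw0 n ((hg.finite i).mem_toFinset.2 n.2), ?_⟩
    rw [← hw]
    exact (Finset.sum_subtype _ (fun x => (hg.finite i).mem_toFinset) fun n => w n • n).symm
  choose w hw0 hw using hw
  have hβ : ∀ i n, 0 < w i n + δ := fun i n => by linarith [hw0 i n]
  refine ⟨fun i => ∑ n : g i, (w i n + δ) • (n : Fin d → ℝ), ⟨?_, fun a ha => ?_⟩, ?_⟩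
  · simp only [add_smul, Finset.sum_add_distrib, hw, hqsum, ← Finset.smul_sum]
    rw [smul_neg, neg_add_cancel]
  · by_contra! hne
    obtain ⟨i₁, i₂, hne⟩ := hne
    have : Nonempty (Fin r) := ⟨i₁⟩
    obtain ⟨k, hk⟩ := Finite.exists_min a
    have hsum0 : ∑ i, ∑ n : g i, (w i n + δ) • (n : Fin d → ℝ) = 0 := by
      simp only [add_smul, Finset.sum_add_distrib, hw, hqsum, ← Finset.smul_sum]
      rw [smul_neg, neg_add_cancel]
    classical
    let I : Finset (Fin r) := Finset.univ.filter fun i => a k < a i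
    have hI : ∀ i, i ∈ I ↔ a k < a i := fun i => by simp [I]
    refine hirr I ?_ ?_ ?_
    · by_contra hemp
      rw [Finset.not_nonempty_iff_eq_empty] at hemp
      have : ∀ i, a i = a k := fun i => ((hk i).eq_or_lt.resolve_right fun h => by
        have := (hI i).2 h
        simp [hemp] at this).symm
      exact hne (by rw [this, this i₂])
    · intro huniv
      have := (hI k).1 (huniv ▸ Finset.mem_univ k)
      exact this.false
    · rw [← Finset.sum_coe_sort I]
      refine zero_mem_intrinsicInterior_sum (g := fun i : I => g i) (fun i => hg.zero_mem i)
        (β := fun j => (a j.1 - a k) * (w j.1 j.2 + δ))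
        (fun j => mul_pos (sub_pos.2 ((hI _).1 j.1.2)) (hβ _ _)) ?_
      rw [Fintype.sum_sigma]
      simp only [mul_smul, ← Finset.smul_sum]
      rw [Finset.sum_coe_sort I fun i => (a i - a k) • ∑ n : g i, (w i n + δ) • (n : Fin d → ℝ)]
      rw [Finset.sum_subset (Finset.subset_univ I) fun i _ hi => by
        rw [hI, not_lt] at hi
        rw [hi.antisymm (hk i), sub_self, zero_smul]]
      simp only [sub_smul, Finset.sum_sub_distrib, ← Finset.smul_sum]
      rw [ha, hsum0, smul_zero, sub_zero]
  · intro i x hx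
    rw [sum_dotProduct]
    refine Finset.sum_nonpos fun n _ => ?_
    rw [smul_dotProduct, smul_eq_mul]
    exact mul_nonpos_of_nonneg_of_nonpos (hβ i n).le ((le_supportFn (hg.finite i) n.2 x).trans hx)

end IsNefData

/-! ### The polytopes `∇` and `∇^∨`. -/

theorem exists_dotProduct_eq (f : (Fin d → ℝ) →L[ℝ] ℝ) : ∃ x : Fin d → ℝ, ∀ y, f y = y ⬝ᵥ x := by
  refine ⟨fun k => f (Pi.single k 1), fun y => ?_⟩
  conv_lhs => rw [pi_eq_sum_univ' y]
  rw [map_sum]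
  refine Finset.sum_congr rfl fun k _ => ?_
  rw [map_smul, smul_eq_mul]

theorem exists_dotProduct_lt {C : Set (Fin d → ℝ)} (hC : Convex ℝ C) (hcl : IsClosed C)
    {q : Fin d → ℝ} (hq : q ∉ C) :
    ∃ (x : Fin d → ℝ) (c : ℝ), (∀ n ∈ C, n ⬝ᵥ x < c) ∧ c < q ⬝ᵥ x := by
  obtain ⟨f, c, hf, hc⟩ := geometric_hahn_banach_closed_point hC hcl hq
  obtain ⟨x, hx⟩ := exists_dotProduct_eq f
  exact ⟨x, c, fun n hn => hx n ▸ hf n hn, hx q ▸ hc⟩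

theorem convex_supportFn_le {B : Set (Fin d → ℝ)} (hB : B.Finite) (hne : B.Nonempty) (c : ℝ) :
    Convex ℝ {x | supportFn B x ≤ c} := by
  intro x hx y hy a b ha hb hab
  have hx : supportFn B x ≤ c := hx
  have hy : supportFn B y ≤ c := hy
  refine (supportFn_add_le hB hne _ _).trans ?_
  rw [supportFn_smul hB hne ha, supportFn_smul hB hne hb]
  have h1 := mul_le_mul_of_nonneg_left hx ha
  have h2 := mul_le_mul_of_nonneg_left hy hb
  have h3 : a * c + b * c = c := by rw [← add_mul, hab, one_mul]
  linarith

theorem finite_intVec_mem {P : Set (Fin d → ℝ)} (hP : Bornology.IsBounded P) :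
    {m : Fin d → ℤ | intVec m ∈ P}.Finite := by
  obtain ⟨C, hC⟩ := hP.exists_norm_le
  refine (Set.finite_Icc (fun _ : Fin d => -⌈C⌉) fun _ => ⌈C⌉).subset fun m hm => ?_
  have h : ∀ k, |(m k : ℝ)| ≤ ⌈C⌉ := fun k =>
    (norm_le_pi_norm (intVec m) k).trans ((hC _ hm).trans (Int.le_ceil C))
  exact ⟨fun k => by exact_mod_cast (abs_le.1 (h k)).1,
    fun k => by exact_mod_cast (abs_le.1 (h k)).2⟩

namespace IsNefData

variable {g : Fin r → Set (Fin d → ℝ)} {T : Finset (Fin d → ℝ)}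

theorem dotProduct_le_supportFn (hg : IsNefData g T) {i : Fin r} {n : Fin d → ℝ}
    (hn : n ∈ convexHull ℝ (g i)) (x : Fin d → ℝ) : n ⬝ᵥ x ≤ supportFn (g i) x :=
  dotProduct_le_of_mem_convexHull (fun _ hb => le_supportFn (hg.finite i) hb x) hn

/-- On `∇^(i)` the function `φ_i` is at most `1` and the other `φ_k` are at most `0`, so
subadditivity gives the bounds. Conversely, each nonzero summand of a decomposition, divided by its
own `φ_j`, is one of the points generating `∇^(j)`. -/
theorem mem_nabla_iff (hg : IsNefData g T) (x : Fin d → ℝ) :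
    x ∈ nabla (fun i => convexHull ℝ (g i)) ↔ ∀ k, supportFn (g k) x ≤ 1 := by
  have hpart : ∀ i, ∀ z ∈ nablaPart (fun i => convexHull ℝ (g i)) i, ∀ k,
      supportFn (g k) z ≤ if k = i then 1 else 0 := fun i z hz k => by
    refine convexHull_min (t := {z | supportFn (g k) z ≤ if k = i then 1 else 0}) ?_
      (convex_supportFn_le (hg.finite k) (hg.nonempty k) _) hz
    rintro v (rfl | ⟨hv, hvi⟩)
    · change supportFn (g k) 0 ≤ _
      rw [supportFn_zero (hg.nonempty k)]
      split_ifs <;> norm_num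
    · rw [supportFn_convexHull (hg.finite i) (hg.nonempty i)] at hvi
      rw [hg.mem_dual_iff, ← Finset.add_sum_erase _ _ (Finset.mem_univ i), hvi] at hv
      change supportFn (g k) v ≤ _
      split_ifs with hki
      · rw [hki, hvi]
      · have := Finset.single_le_sum (f := fun k => supportFn (g k) v)
          (fun k _ => hg.nonneg k v) (Finset.mem_erase.2 ⟨hki, Finset.mem_univ k⟩)
        linarith
  constructor
  · intro hx k
    obtain ⟨f, hf, rfl⟩ := (mem_fintype_sum _ _).1 hx
    refine (supportFn_sum_le (hg.finite k) (hg.nonempty k) _ _).trans ?_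
    refine (Finset.sum_le_sum fun i _ => hpart i (f i) (hf i) k).trans ?_
    simp
  · intro hx
    obtain ⟨a, ha, rfl⟩ := hg.isDecomposing.exists_decomp x
    refine (mem_fintype_sum _ _).2 ⟨a, fun j => ?_, rfl⟩
    have hconv : Convex ℝ (nablaPart (fun i => convexHull ℝ (g i)) j) := convex_convexHull ℝ _
    have h0 : 0 ∈ nablaPart (fun i => convexHull ℝ (g i)) j :=
      subset_convexHull ℝ _ (Or.inl rfl)
    by_cases haj : a j = 0
    · rwa [haj]
    have hpos := hg.isDecomposing.pos_diag ha haj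
    set c := supportFn (g j) (a j) with hc
    have hmem : c⁻¹ • a j ∈ nablaPart (fun i => convexHull ℝ (g i)) j := by
      refine subset_convexHull ℝ _ (Or.inr ⟨?_, ?_⟩)
      · rw [hg.mem_dual_iff, ← Finset.add_sum_erase _ _ (Finset.mem_univ j)]
        simp only [supportFn_smul (hg.finite _) (hg.nonempty _) (inv_pos.2 hpos).le]
        rw [← hc, inv_mul_cancel₀ hpos.ne', ← Finset.mul_sum]
        have := mul_nonpos_of_nonneg_of_nonpos (inv_pos.2 hpos).le
          (Finset.sum_nonpos (s := Finset.univ.erase j) (f := fun k => supportFn (g k) (a j))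
            fun k hk => ha.off_le k j (Finset.ne_of_mem_erase hk))
        linarith
      · rw [supportFn_convexHull (hg.finite j) (hg.nonempty j),
          supportFn_smul (hg.finite _) (hg.nonempty _) (inv_pos.2 hpos).le, ← hc,
          inv_mul_cancel₀ hpos.ne']
    have := hconv.smul_mem_of_zero_mem h0 hmem (t := c) ⟨hpos.le, (ha.diag_le j).trans (hx j)⟩
    rwa [smul_smul, mul_inv_cancel₀ hpos.ne', one_smul] at this

theorem mem_nablaDual_iff (hg : IsNefData g T) (q : Fin d → ℝ) :
    q ∈ nablaDual (fun i => convexHull ℝ (g i)) ↔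
      ∀ x, (∀ k, supportFn (g k) x ≤ 1) → q ⬝ᵥ x ≤ 1 := by
  simp only [← hg.mem_nabla_iff]
  exact forall₂_congr fun x _ => by rw [dotProduct_comm]

theorem convexHull_subset_nablaDual (hg : IsNefData g T) (i : Fin r) :
    convexHull ℝ (g i) ⊆ nablaDual fun i => convexHull ℝ (g i) := fun _ hq =>
  (hg.mem_nablaDual_iff _).2 fun x hx => (hg.dotProduct_le_supportFn hq x).trans (hx i)

theorem zero_mem_nablaDual (hg : IsNefData g T) :
    0 ∈ nablaDual fun i => convexHull ℝ (g i) :=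
  (hg.mem_nablaDual_iff _).2 fun x _ => by simp

theorem convex_nablaDual (hg : IsNefData g T) :
    Convex ℝ (nablaDual fun i => convexHull ℝ (g i)) := by
  intro p hp q hq a b ha hb hab
  rw [hg.mem_nablaDual_iff] at hp hq ⊢
  intro x hx
  rw [add_dotProduct, smul_dotProduct, smul_dotProduct, smul_eq_mul, smul_eq_mul, ← hab]
  nlinarith [hp x hx, hq x hx]

/-- A form separating `q` from the hull bounds every `φ_k` by a constant `c`; after division by `c`
it lies in `∇` and violates the inequality for `q`. If `c = 0`, the form itself is zero. -/
theorem nablaDual_eq (hg : IsNefData g T) :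
    nablaDual (fun i => convexHull ℝ (g i)) = convexHull ℝ (⋃ i, g i) := by
  refine Subset.antisymm (fun q hq => ?_) ?_
  · by_contra hne
    have hfin : (⋃ i, g i).Finite := finite_iUnion hg.finite
    obtain ⟨x, c, hx, hc⟩ := exists_dotProduct_lt (convex_convexHull ℝ _)
      (hfin.isClosed_convexHull ℝ) hne
    have h0 : ∀ k, supportFn (g k) x ≤ c := fun k => supportFn_le (hg.nonempty k) fun n hn =>
      (hx n (subset_convexHull ℝ _ (mem_iUnion_of_mem k hn))).le
    have hc0 : 0 ≤ c := (hg.nonneg ⟨0, hg.one_le⟩ x).trans (h0 _)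
    rw [hg.mem_nablaDual_iff] at hq
    rcases hc0.eq_or_lt with h | h
    · have hx0 : x = 0 := by
        by_contra hx0
        obtain ⟨i, hi⟩ := hg.pos x hx0
        exact absurd (h0 i) (by rw [← h]; exact hi.not_ge)
      rw [hx0, dotProduct_zero] at hc
      exact hc0.not_gt hc
    · have := hq (c⁻¹ • x) fun k => by
        rw [supportFn_smul (hg.finite k) (hg.nonempty k) (inv_pos.2 h).le, inv_mul_le_one₀ h]
        exact h0 k
      rw [dotProduct_smul, smul_eq_mul, inv_mul_le_one₀ h] at this
      exact this.not_gt hc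
  · exact convexHull_min (iUnion_subset fun i => (subset_convexHull ℝ _).trans
      (hg.convexHull_subset_nablaDual i)) hg.convex_nablaDual

theorem isCompact_nablaDual (hg : IsNefData g T) :
    IsCompact (nablaDual fun i => convexHull ℝ (g i)) := by
  rw [hg.nablaDual_eq]
  exact (finite_iUnion hg.finite).isCompact_convexHull ℝ

theorem finite_lattice (hg : IsNefData g T) :
    {m : Fin d → ℤ | intVec m ∈ nablaDual fun i => convexHull ℝ (g i)}.Finite :=
  finite_intVec_mem hg.isCompact_nablaDual.isBounded

theorem convexHull_lattice (hg : IsNefData g T) :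
    convexHull ℝ (intVec '' {m : Fin d → ℤ | intVec m ∈ nablaDual fun i => convexHull ℝ (g i)}) =
      nablaDual fun i => convexHull ℝ (g i) := by
  refine Subset.antisymm (convexHull_min (image_subset_iff.2 fun m hm => hm)
    hg.convex_nablaDual) ?_
  conv_lhs => rw [hg.nablaDual_eq]
  refine convexHull_mono (iUnion_subset fun i n hn => ?_)
  obtain ⟨m, rfl⟩ := hg.integral i n hn
  exact ⟨m, hg.convexHull_subset_nablaDual i (subset_convexHull ℝ _ hn), rfl⟩

theorem zero_mem_interior_nablaDual (hg : IsNefData g T) :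
    0 ∈ interior (nablaDual fun i => convexHull ℝ (g i)) := by
  obtain ⟨C, hC⟩ := (hg.isDecomposing.isCompact_sublevel 1).isBounded.exists_norm_le
  have hcont : Continuous fun q : Fin d → ℝ => (∑ k, |q k|) * C := by fun_prop
  refine mem_interior_iff_mem_nhds.2 ?_
  have hev : ∀ᶠ q in 𝓝 (0 : Fin d → ℝ), (∑ k, |q k|) * C < 1 :=
    hcont.continuousAt.eventually_lt continuousAt_const (by simp)
  filter_upwards [hev] with q hq
  exact (hg.mem_nablaDual_iff q).2 fun x hx => (dotProduct_le_mul_norm q x).trans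
    ((mul_le_mul_of_nonneg_left (hC x hx) (Finset.sum_nonneg fun k _ => abs_nonneg _)).trans hq.le)

theorem supportFn_face_le (hg : IsNefData g T) {v : Fin d → ℝ} {j : Fin r}
    (hv : v ∈ face g T j) (k : Fin r) : supportFn (g k) v = if k = j then 1 else 0 := by
  split_ifs with h
  · rw [h]
    exact (mem_face.1 hv).2
  · exact hg.supportFn_of_mem_face hv h

theorem eq_zero_of_face_le (hg : IsNefData g T) {p : Fin d → ℝ}
    (h : ∀ j, ∀ v ∈ face g T j, p ⬝ᵥ v ≤ 0) : p = 0 := by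
  have := hg.dotProduct_le_of_face (κ := 0) h p
  simp only [Pi.zero_apply, zero_mul, Finset.sum_const_zero] at this
  exact dotProduct_self_eq_zero.1
    (this.antisymm (Finset.sum_nonneg fun k _ => mul_self_nonneg (p k)))

/-- A nonzero lattice point of `∇^∨` lies in one of the summands of the nef-partition. -/
theorem exists_mem_of_lattice (hg : IsNefData g T) {m : Fin d → ℤ}
    (hm : intVec m ∈ nablaDual fun i => convexHull ℝ (g i)) (hm0 : intVec m ≠ 0) :
    ∃ i, intVec m ∈ convexHull ℝ (g i) := by
  rw [hg.mem_nablaDual_iff] at hm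
  obtain ⟨j, v, hv, hmv⟩ : ∃ j, ∃ v ∈ face g T j, 0 < intVec m ⬝ᵥ v := by
    by_contra! h
    exact hm0 (hg.eq_zero_of_face_le h)
  have hint : ∀ k, ∀ w ∈ face g T k, 0 < intVec m ⬝ᵥ w → 1 ≤ intVec m ⬝ᵥ w := fun k w hw h => by
    obtain ⟨z, rfl⟩ := hg.integral_dual w (mem_face.1 hw).1
    rw [intVec_dotProduct] at h ⊢
    exact_mod_cast h
  have hκ : ∀ k, ∀ w ∈ face g T k, intVec m ⬝ᵥ w ≤ (Pi.single j 1 : Fin r → ℝ) k := by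
    intro k w hw
    rcases eq_or_ne k j with rfl | hkj
    · rw [Pi.single_eq_same]
      refine hm w fun i => ?_
      rw [hg.supportFn_face_le hw]
      split_ifs <;> norm_num
    · rw [Pi.single_eq_of_ne hkj]
      by_contra! hpos
      have h1 := hint k w hw hpos
      have h2 := hint j v hv hmv
      have h3 := hm (w + v) fun i => by
        refine (supportFn_add_le (hg.finite i) (hg.nonempty i) w v).trans ?_
        rw [hg.supportFn_face_le hw, hg.supportFn_face_le hv]
        split_ifs with hik hij
        · exact absurd (hik.symm.trans hij) hkj
        all_goals norm_num
      rw [dotProduct_add] at h3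
      linarith
  refine ⟨j, ?_⟩
  -- The bounds on the faces give `⟨m, ·⟩ ≤ φ_j` everywhere, which no separating form can satisfy.
  by_contra hnot
  obtain ⟨x, c, hx, hc⟩ := exists_dotProduct_lt (convex_convexHull ℝ _)
    ((hg.finite j).isClosed_convexHull ℝ) hnot
  have h1 := hg.dotProduct_le_of_face hκ x
  rw [Finset.sum_eq_single j (fun k _ hk => by rw [Pi.single_eq_of_ne hk, zero_mul]) (by simp),
    Pi.single_eq_same, one_mul] at h1
  have h2 : supportFn (g j) x ≤ c := supportFn_le (hg.nonempty j) fun n hn =>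
    (hx n (subset_convexHull ℝ _ hn)).le
  linarith

end IsNefData

/-! ### Regular subdivisions and tight lattice points. -/

section

/-- The nonnegative weighted deficits `w s * (f p - f s)` sum to zero, so only points with `f s = f
p` carry weight. -/
theorem mem_convexHull_of_le {E : Type*} [AddCommGroup E] [Module ℝ E] {S : Set E}
    (hS : S.Finite) (f : E →ₗ[ℝ] ℝ) {p : E} (hp : p ∈ convexHull ℝ S)
    (hle : ∀ s ∈ S, f s ≤ f p) : p ∈ convexHull ℝ {s | s ∈ S ∧ f s = f p} := by
  classical
  rw [← hS.coe_toFinset] at hp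
  obtain ⟨w, hw0, hw1, hwp⟩ := Finset.mem_convexHull'.1 hp
  have hsum : ∑ s ∈ hS.toFinset, w s * (f p - f s) = 0 := by
    simp only [mul_sub, Finset.sum_sub_distrib, ← Finset.sum_mul, hw1, one_mul]
    conv_lhs => rw [← hwp]
    simp [map_sum]
  have hzero := (Finset.sum_eq_zero_iff_of_nonneg fun s hs => mul_nonneg (hw0 s hs)
    (sub_nonneg.2 (hle s (hS.mem_toFinset.1 hs)))).1 hsum
  have hw : ∀ s ∈ hS.toFinset, w s ≠ 0 → f s = f p := fun s hs h =>
    (sub_eq_zero.1 ((mul_eq_zero.1 (hzero s hs)).resolve_left h)).symm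
  have hset : {s | s ∈ S ∧ f s = f p} = (hS.toFinset.filter fun s => f s = f p : Finset E) := by
    ext s
    simp
  rw [hset]
  refine Finset.mem_convexHull'.2 ⟨w, fun s hs => hw0 s (Finset.mem_filter.1 hs).1, ?_, ?_⟩
  · rw [Finset.sum_filter_of_ne hw, hw1]
  · rw [Finset.sum_filter_of_ne fun s hs h => hw s hs fun h0 => h (by rw [h0, zero_smul]), hwp]

theorem setOf_max_convexHull {E : Type*} [AddCommGroup E] [Module ℝ E] {S : Set E}
    (hS : S.Finite) (f : E →ₗ[ℝ] ℝ) :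
    {p | p ∈ convexHull ℝ S ∧ ∀ q ∈ convexHull ℝ S, f q ≤ f p} =
      convexHull ℝ {s | s ∈ S ∧ ∀ s' ∈ S, f s' ≤ f s} := by
  apply Subset.antisymm
  · rintro p ⟨hp, hmax⟩
    have hle : ∀ s ∈ S, f s ≤ f p := fun s hs => hmax s (subset_convexHull ℝ S hs)
    refine convexHull_mono ?_ (mem_convexHull_of_le hS f hp hle)
    rintro s ⟨hs, hsp⟩
    exact ⟨hs, fun s' hs' => hsp ▸ hle s' hs'⟩
  · refine convexHull_min ?_ ?_
    · rintro s ⟨hs, hmax⟩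
      refine ⟨subset_convexHull ℝ S hs, fun q hq => ?_⟩
      exact convexHull_min (t := {q | f q ≤ f s}) hmax (convex_halfSpace_le f.isLinear _) hq
    · rintro p ⟨hp, hpmax⟩ q ⟨hq, hqmax⟩ a b ha hb hab
      refine ⟨convex_convexHull ℝ S hp hq ha hb hab, fun z hz => ?_⟩
      rw [map_add, map_smul, map_smul, smul_eq_mul, smul_eq_mul]
      have h1 := mul_le_mul_of_nonneg_left (hpmax z hz) ha
      have h2 := mul_le_mul_of_nonneg_left (hqmax z hz) hb
      have h3 : a * f z + b * f z = f z := by rw [← add_mul, hab, one_mul]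
      linarith

/-- The linear form `⟨·, x⟩`. -/
def dotLin (x : Fin d → ℝ) : (Fin d → ℝ) →ₗ[ℝ] ℝ where
  toFun y := y ⬝ᵥ x
  map_add' a b := add_dotProduct a b x
  map_smul' c a := smul_dotProduct c a x

@[simp] theorem dotLin_apply (x y : Fin d → ℝ) : dotLin x y = y ⬝ᵥ x := rfl

@[simp] theorem intVec_zero : intVec (0 : Fin d → ℤ) = 0 := by
  ext k
  simp [intVec]

theorem intVec_injective : Function.Injective (intVec (d := d)) := fun m n h => by
  ext k
  have := congrFun h k
  simpa [intVec] using this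

theorem intVec_eq_zero {m : Fin d → ℤ} : intVec m = 0 ↔ m = 0 := by
  rw [← intVec_zero, intVec_injective.eq_iff]

variable {P : Set (Fin d → ℝ)} {ω : (Fin d → ℤ) → ℝ}

/-- The lattice points of `P` at which `⟨·, y⟩ - ω` is maximal. -/
def tight (P : Set (Fin d → ℝ)) (ω : (Fin d → ℤ) → ℝ) (y : Fin d → ℝ) : Set (Fin d → ℤ) :=
  {m | intVec m ∈ P ∧ ∀ m', intVec m' ∈ P → intVec m' ⬝ᵥ y - ω m' ≤ intVec m ⬝ᵥ y - ω m}

theorem finite_tight (hP : {m | intVec m ∈ P}.Finite) (y : Fin d → ℝ) : (tight P ω y).Finite :=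
  hP.subset fun _ hm => hm.1

theorem tight_nonempty (hP : {m | intVec m ∈ P}.Finite) (hne : {m | intVec m ∈ P}.Nonempty)
    (y : Fin d → ℝ) : (tight P ω y).Nonempty := by
  obtain ⟨m, hm, hmax⟩ := exists_max_image _ (fun m => intVec m ⬝ᵥ y - ω m) hP hne
  exact ⟨m, hm, hmax⟩

theorem isCell_iff (hP : {m | intVec m ∈ P}.Finite) {σ : Set (Fin d → ℝ)} :
    IsCell P ω σ ↔ ∃ y, σ = convexHull ℝ (intVec '' tight P ω y) := by
  refine exists_congr fun y => ?_
  let f : (Fin d → ℝ) × ℝ →ₗ[ℝ] ℝ :=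
    (dotLin y).comp (LinearMap.fst ℝ _ _) - LinearMap.snd ℝ _ _
  have h := setOf_max_convexHull (hP.image fun m => (intVec m, ω m)) f
  have hset : {s | s ∈ (fun m => (intVec m, ω m)) '' {m | intVec m ∈ P} ∧
      ∀ s' ∈ (fun m => (intVec m, ω m)) '' {m | intVec m ∈ P}, f s' ≤ f s} =
      (fun m => (intVec m, ω m)) '' tight P ω y := by
    ext s
    constructor
    · rintro ⟨⟨m, hm, rfl⟩, hmax⟩
      exact ⟨m, ⟨hm, fun m' hm' => hmax _ ⟨m', hm', rfl⟩⟩, rfl⟩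
    · rintro ⟨m, ⟨hm, hmax⟩, rfl⟩
      exact ⟨⟨m, hm, rfl⟩, forall_mem_image.2 fun m' hm' => hmax m' hm'⟩
  rw [hset] at h
  have himg : Prod.fst '' convexHull ℝ ((fun m => (intVec m, ω m)) '' tight P ω y) =
      convexHull ℝ (intVec '' tight P ω y) := by
    have := (LinearMap.fst ℝ (Fin d → ℝ) ℝ).image_convexHull
      ((fun m => (intVec m, ω m)) '' tight P ω y)
    rw [image_image] at this
    exact this
  rw [← himg, ← h]
  rfl

theorem exists_pos_perturb (hP : {m | intVec m ∈ P}.Finite) (y x : Fin d → ℝ) :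
    ∃ δ : ℝ, 0 < δ ∧ ∀ m, intVec m ∈ P → m ∉ tight P ω y → ∀ m₀ ∈ tight P ω y,
      intVec m ⬝ᵥ (y + δ • x) - ω m < intVec m₀ ⬝ᵥ (y + δ • x) - ω m₀ := by
  have hev : ∀ᶠ δ in 𝓝 (0 : ℝ), ∀ m ∈ {m | intVec m ∈ P}, m ∉ tight P ω y →
      ∀ m₀ ∈ tight P ω y, intVec m ⬝ᵥ (y + δ • x) - ω m < intVec m₀ ⬝ᵥ (y + δ • x) - ω m₀ := by
    refine (eventually_all_finite hP).2 fun m hm => eventually_imp_distrib_left.2 fun hmt =>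
      (eventually_all_finite (finite_tight hP y)).2 fun m₀ hm₀ => ?_
    have hc : ∀ m, Continuous fun δ : ℝ => intVec m ⬝ᵥ (y + δ • x) - ω m := fun m =>
      (continuous_const.dotProduct (by fun_prop)).sub continuous_const
    refine (hc m).continuousAt.eventually_lt (hc m₀).continuousAt ?_
    simp only [zero_smul, add_zero]
    by_contra! h
    exact hmt ⟨hm, fun m' hm' => (hm₀.2 m' hm').trans h⟩
  have hev' := (hev.filter_mono (nhdsWithin_le_nhds (s := Ioi 0))).and self_mem_nhdsWithin
  obtain ⟨δ, hδ, hδ0⟩ := hev'.exists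
  exact ⟨δ, hδ0, hδ⟩

/-- To first order, moving `y` along `x` selects from the tight points those on which `x` is
maximal. -/
theorem tight_add_smul {y x : Fin d → ℝ} {δ c : ℝ} (hδ : 0 < δ)
    (hpert : ∀ m, intVec m ∈ P → m ∉ tight P ω y → ∀ m₀ ∈ tight P ω y,
      intVec m ⬝ᵥ (y + δ • x) - ω m < intVec m₀ ⬝ᵥ (y + δ • x) - ω m₀)
    (hc : ∀ m ∈ tight P ω y, intVec m ⬝ᵥ x ≤ c) (hne : ∃ m ∈ tight P ω y, intVec m ⬝ᵥ x = c) :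
    tight P ω (y + δ • x) = {m | m ∈ tight P ω y ∧ intVec m ⬝ᵥ x = c} := by
  obtain ⟨m₀, hm₀, hm₀c⟩ := hne
  have hval : ∀ m, intVec m ⬝ᵥ (y + δ • x) - ω m =
      intVec m ⬝ᵥ y - ω m + δ * (intVec m ⬝ᵥ x) := fun m => by
    rw [dotProduct_add, dotProduct_smul, smul_eq_mul]
    ring
  ext m
  constructor
  · rintro ⟨hm, hmax⟩
    have hmt : m ∈ tight P ω y := by
      by_contra h
      exact (hpert m hm h m₀ hm₀).not_ge (hmax m₀ hm₀.1)
    refine ⟨hmt, (hc m hmt).antisymm ?_⟩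
    have h1 := hmax m₀ hm₀.1
    rw [hval, hval, hm₀c] at h1
    have h2 := hm₀.2 m hmt.1
    exact le_of_mul_le_mul_left (by linarith) hδ
  · rintro ⟨hmt, hmc⟩
    refine ⟨hmt.1, fun m' hm' => ?_⟩
    by_cases h : m' ∈ tight P ω y
    · rw [hval, hval, hmc]
      have h1 := hmt.2 m' hm'
      have h2 := mul_le_mul_of_nonneg_left (hc m' h) hδ.le
      linarith
    · exact (hpert m' hm' h m hmt).le

theorem exists_central_cell (hP : {m | intVec m ∈ P}.Finite) (hω : IsCentral P ω)
    (y : Fin d → ℝ) : ∃ y', convexHull ℝ (intVec '' tight P ω y) ⊆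
      convexHull ℝ (intVec '' tight P ω y') ∧ 0 ∈ tight P ω y' ∧
      (0 : Fin d → ℝ) ∉ convexHull ℝ (intVec '' (tight P ω y' \ {0})) := by
  have hfin : {σ | IsCell P ω σ}.Finite := by
    refine (hP.finite_subsets.image fun s => convexHull ℝ (intVec '' s)).subset fun σ hσ => ?_
    obtain ⟨z, rfl⟩ := (isCell_iff hP).1 hσ
    exact ⟨_, fun m hm => hm.1, rfl⟩
  obtain ⟨σ, hle, hσ⟩ := hfin.exists_le_maximal
    (show convexHull ℝ (intVec '' tight P ω y) ∈ {σ | IsCell P ω σ} from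
      (isCell_iff hP).2 ⟨y, rfl⟩)
  have h0 := hω σ hσ
  obtain ⟨y', rfl⟩ := (isCell_iff hP).1 hσ.1
  refine ⟨y', hle, ?_, fun h => ?_⟩
  · obtain ⟨m, hm, hm0⟩ := extremePoints_convexHull_subset h0
    rwa [intVec_eq_zero.1 hm0] at hm
  · have hconv := ((convex_convexHull ℝ _).mem_extremePoints_iff_convex_sdiff.1 h0).2
    refine (convexHull_min (fun v hv => ?_) hconv h).2 rfl
    obtain ⟨m, ⟨hm, hm0⟩, rfl⟩ := hv
    exact ⟨subset_convexHull ℝ _ (mem_image_of_mem _ hm), fun h => hm0 (intVec_eq_zero.1 h)⟩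

/-- In a maximal cell the origin is a vertex, so some `x` is negative on all other tight points;
moving slightly along `x` leaves the origin as the only maximizer. -/
theorem exists_strict_center (hP : {m | intVec m ∈ P}.Finite) (hω : IsCentral P ω) :
    ∃ y₀, ∀ m, intVec m ∈ P → m ≠ 0 → intVec m ⬝ᵥ y₀ - ω m < -ω 0 := by
  obtain ⟨y, -, h0, hnot⟩ := exists_central_cell hP hω 0
  obtain ⟨x, c, hx, hc⟩ := exists_dotProduct_lt (convex_convexHull ℝ _)
    ((((finite_tight hP y).subset sdiff_subset).image _).isClosed_convexHull ℝ) hnot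
  obtain ⟨δ, hδ, hpert⟩ := exists_pos_perturb (ω := ω) hP y x
  refine ⟨y + δ • x, fun m hm hm0 => ?_⟩
  by_cases hmt : m ∈ tight P ω y
  · have h1 := hx _ (subset_convexHull ℝ _ (mem_image_of_mem intVec ⟨hmt, hm0⟩))
    have h2 := h0.2 m hm
    rw [zero_dotProduct] at hc
    rw [intVec_zero, zero_dotProduct, zero_sub] at h2
    rw [dotProduct_add, dotProduct_smul, smul_eq_mul]
    nlinarith
  · simpa using hpert m hm hmt 0 h0

/-- The cells cover the interior of the polytope. -/
theorem exists_mem_cell (hP : {m | intVec m ∈ P}.Finite)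
    (hPconv : convexHull ℝ (intVec '' {m | intVec m ∈ P}) = P) {q : Fin d → ℝ}
    (hq : q ∈ interior P) : ∃ y, q ∈ convexHull ℝ (intVec '' tight P ω y) := by
  have hne : {m : Fin d → ℤ | intVec m ∈ P}.Nonempty := by
    have : P.Nonempty := ⟨q, interior_subset hq⟩
    rw [← hPconv, convexHull_nonempty_iff, image_nonempty] at this
    exact this
  set L := hP.toFinset with hL
  have hLne : L.Nonempty := hP.toFinset_nonempty.2 hne
  -- A minimizer of this convex function is the required `y`. The sublevel set is compact because
  -- `q` is interior, and if `q` were separated from the tight points, a step along the separating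
  -- direction would decrease `h`.
  let h : (Fin d → ℝ) → ℝ := fun y => L.sup' hLne fun m => (intVec m - q) ⬝ᵥ y - ω m
  have hcont : Continuous h := by
    refine Continuous.finset_sup'_apply hLne fun m _ => ?_
    exact (continuous_const.dotProduct continuous_id).sub continuous_const
  set B : Set (Fin d → ℝ) := (fun m => intVec m - q) '' {m | intVec m ∈ P} with hBdef
  have hB : B.Finite := hP.image _
  have hBne : B.Nonempty := hne.image _
  have hBpos : ∀ x, x ≠ 0 → 0 < supportFn B x := by
    intro x hx
    have hc : Continuous fun δ : ℝ => q + δ • x := by fun_prop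
    have hev : ∀ᶠ δ in 𝓝[>] (0 : ℝ), q + δ • x ∈ P :=
      nhdsWithin_le_nhds (hc.continuousAt.eventually_mem
        (by rw [zero_smul, add_zero]; exact mem_interior_iff_mem_nhds.1 hq))
    obtain ⟨δ, hδ, hδ0⟩ := (hev.and self_mem_nhdsWithin).exists
    have hδ0 : 0 < δ := hδ0
    rw [← hPconv] at hδ
    by_contra! hle
    have h1 : (q + δ • x) ⬝ᵥ x ≤ q ⬝ᵥ x := dotProduct_le_of_mem_convexHull
      (forall_mem_image.2 fun m hm => by
        have := (le_supportFn hB (mem_image_of_mem _ hm) x).trans hle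
        rw [sub_dotProduct] at this
        linarith) hδ
    rw [add_dotProduct, smul_dotProduct, smul_eq_mul] at h1
    have h2 : 0 ≤ x ⬝ᵥ x := Finset.sum_nonneg fun k _ => mul_self_nonneg (x k)
    exact hx (dotProduct_self_eq_zero.1 (by nlinarith))
  obtain ⟨W, hW⟩ := (hP.image ω).bddAbove
  have hcomp : IsCompact {y | h y ≤ h 0} := by
    have h1 : IsCompact {x : Fin d → ℝ | supportFn B x ≤ h 0 + W} := by
      simpa using isCompact_cone_sublevel (ι := Unit) (K := univ) isClosed_univ
        (fun _ _ _ _ => mem_univ _) (F := fun _ => supportFn B)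
        (fun _ => continuous_supportFn hB hBne)
        (fun _ x c hc => supportFn_smul hB hBne hc x) (fun x _ hx => ⟨(), hBpos x hx⟩) (h 0 + W)
    refine h1.of_isClosed_subset (isClosed_le hcont continuous_const) fun y hy => ?_
    refine supportFn_le hBne (forall_mem_image.2 fun m hm => ?_)
    have h2 : (intVec m - q) ⬝ᵥ y - ω m ≤ h y :=
      Finset.le_sup' (fun m => (intVec m - q) ⬝ᵥ y - ω m) (hP.mem_toFinset.2 hm)
    have h3 : ω m ≤ W := hW (mem_image_of_mem _ hm)
    have h4 : h y ≤ h 0 := hy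
    linarith
  obtain ⟨y, hy, hmin⟩ := hcomp.exists_isMinOn ⟨0, le_refl (h 0)⟩ hcont.continuousOn
  have hmin' : ∀ z, h y ≤ h z := fun z => by
    rcases le_total (h z) (h 0) with hz | hz
    · exact hmin hz
    · exact le_trans hy hz
  refine ⟨y, ?_⟩
  by_contra hnot
  obtain ⟨x, c, hx, hc⟩ := exists_dotProduct_lt (convex_convexHull ℝ _)
    (((finite_tight hP y).image _).isClosed_convexHull ℝ) hnot
  obtain ⟨δ, hδ, hpert⟩ := exists_pos_perturb (ω := ω) hP y x
  obtain ⟨m₀, hm₀⟩ := tight_nonempty (ω := ω) hP hne y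
  have hlt : ∀ m ∈ tight P ω y, (intVec m - q) ⬝ᵥ (y + δ • x) - ω m < h y := fun m hm => by
    have h1 := hx _ (subset_convexHull ℝ _ (mem_image_of_mem intVec hm))
    have h2 : (intVec m - q) ⬝ᵥ y - ω m ≤ h y :=
      Finset.le_sup' (fun m => (intVec m - q) ⬝ᵥ y - ω m) (hP.mem_toFinset.2 hm.1)
    rw [dotProduct_add, dotProduct_smul, smul_eq_mul, sub_dotProduct _ _ x]
    nlinarith
  refine (hmin' (y + δ • x)).not_gt ((Finset.sup'_lt_iff hLne).2 fun m hm => ?_)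
  have hmP : intVec m ∈ P := hP.mem_toFinset.1 hm
  by_cases hmt : m ∈ tight P ω y
  · exact hlt m hmt
  · refine lt_trans ?_ (hlt m₀ hm₀)
    have := hpert m hmP hmt m₀ hm₀
    rw [sub_dotProduct, sub_dotProduct]
    linarith

end

/-! ### Transversal cells and the tight locus. -/

theorem exists_supporting {P σ : Set (Fin d → ℝ)} (hP : Convex ℝ P) (h0 : 0 ∈ interior P)
    (hσ : Convex ℝ σ) (hσP : σ ⊆ P) (hσf : σ ⊆ frontier P) :
    ∃ x : Fin d → ℝ, ∀ n ∈ σ, n ⬝ᵥ x = 1 := by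
  obtain ⟨f, u, hfu, huf⟩ := geometric_hahn_banach_open hP.interior isOpen_interior hσ
    (disjoint_left.2 fun n hn hnσ => (hσf hnσ).2 hn)
  have hu : 0 < u := by simpa using hfu 0 h0
  have hle : ∀ n ∈ P, f n ≤ u := fun n hn => by
    have h1 : n ∈ closure (interior P) := by
      rw [hP.closure_interior_eq_closure_of_nonempty_interior ⟨0, h0⟩]
      exact subset_closure hn
    exact closure_minimal (t := {n | f n ≤ u}) (fun m hm => (hfu m hm).le)
      (isClosed_le f.continuous continuous_const) h1
  obtain ⟨x, hx⟩ := exists_dotProduct_eq f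
  refine ⟨u⁻¹ • x, fun n hn => ?_⟩
  rw [dotProduct_smul, smul_eq_mul, ← hx, (hle n (hσP hn)).antisymm (huf n hn),
    inv_mul_cancel₀ hu.ne']

theorem exists_eq_smul_of_mem_coneCell {σ : Set (Fin d → ℝ)} (hσ : Convex ℝ σ)
    (hne : σ.Nonempty) {z : Fin d → ℝ} (hz : z ∈ coneCell σ) :
    ∃ t : ℝ, 0 ≤ t ∧ t ≤ 1 ∧ ∃ s ∈ σ, z = t • s := by
  rw [coneCell, singleton_union, convexHull_insert hne, hσ.convexHull_eq] at hz
  obtain ⟨_, rfl, s, hs, a, b, ha, hb, hab, rfl⟩ := mem_convexJoin.1 hz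
  exact ⟨b, hb, by linarith, s, hs, by rw [smul_zero, zero_add]⟩

theorem zero_mem_extremePoints_coneCell {σ : Set (Fin d → ℝ)} (hσ : Convex ℝ σ)
    (hne : σ.Nonempty) {x : Fin d → ℝ} (hx : ∀ n ∈ σ, n ⬝ᵥ x = 1) :
    0 ∈ (coneCell σ).extremePoints ℝ := by
  refine mem_extremePoints.2 ⟨subset_convexHull ℝ _ (Or.inl rfl), ?_⟩
  intro z₁ hz₁ z₂ hz₂ ⟨a, b, ha, hb, hab, h⟩
  obtain ⟨t₁, ht₁, -, s₁, hs₁, rfl⟩ := exists_eq_smul_of_mem_coneCell hσ hne hz₁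
  obtain ⟨t₂, ht₂, -, s₂, hs₂, rfl⟩ := exists_eq_smul_of_mem_coneCell hσ hne hz₂
  have h' := congrArg (· ⬝ᵥ x) h
  simp only [add_dotProduct, smul_dotProduct, hx s₁ hs₁, hx s₂ hs₂, smul_eq_mul, mul_one,
    zero_dotProduct] at h'
  have h1 := mul_nonneg ha.le ht₁
  have h2 := mul_nonneg hb.le ht₂
  have h3 : t₁ = 0 := (mul_eq_zero.1 (by linarith : a * t₁ = 0)).resolve_left ha.ne'
  have h4 : t₂ = 0 := (mul_eq_zero.1 (by linarith : b * t₂ = 0)).resolve_left hb.ne'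
  simp [h3, h4]

/-- The form `⟨·, x⟩` measures height in the cone and is at most `1` there, so a segment through a
point of height `1` has both ends in `σ`. -/
theorem extremePoints_subset_coneCell {σ : Set (Fin d → ℝ)} (hσ : Convex ℝ σ)
    {x : Fin d → ℝ} (hx : ∀ n ∈ σ, n ⬝ᵥ x = 1) :
    σ.extremePoints ℝ ⊆ (coneCell σ).extremePoints ℝ := by
  intro v hv
  have hne : σ.Nonempty := ⟨v, hv.1⟩
  refine mem_extremePoints.2 ⟨subset_convexHull ℝ _ (Or.inr hv.1), ?_⟩
  intro z₁ hz₁ z₂ hz₂ ⟨a, b, ha, hb, hab, h⟩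
  obtain ⟨t₁, ht₁, ht₁', s₁, hs₁, rfl⟩ := exists_eq_smul_of_mem_coneCell hσ hne hz₁
  obtain ⟨t₂, ht₂, ht₂', s₂, hs₂, rfl⟩ := exists_eq_smul_of_mem_coneCell hσ hne hz₂
  have h' := congrArg (· ⬝ᵥ x) h
  simp only [add_dotProduct, smul_dotProduct, hx s₁ hs₁, hx s₂ hs₂, smul_eq_mul, mul_one,
    hx v hv.1] at h'
  have h1 := mul_le_mul_of_nonneg_left ht₁' ha.le
  have h2 := mul_le_mul_of_nonneg_left ht₂' hb.le
  have h3 : t₁ = 1 := ht₁'.antisymm (le_of_mul_le_mul_left (by linarith) ha)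
  have h4 : t₂ = 1 := ht₂'.antisymm (le_of_mul_le_mul_left (by linarith) hb)
  subst h3 h4
  rw [one_smul, one_smul] at h ⊢
  exact (mem_extremePoints.1 hv).2 s₁ hs₁ s₂ hs₂ ⟨a, b, ha, hb, hab, h⟩

/-- The polytope `∇^∨` of the nef-partition generated by the `g i`. -/
abbrev dualNabla (g : Fin r → Set (Fin d → ℝ)) : Set (Fin d → ℝ) :=
  nablaDual fun i => convexHull ℝ (g i)

/-- The points at which `0` and a nonzero lattice point of each summand are tight. -/
def tightLocus (g : Fin r → Set (Fin d → ℝ)) (ω : (Fin d → ℤ) → ℝ) : Set (Fin d → ℝ) :=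
  {y | 0 ∈ tight (dualNabla g) ω y ∧
    ∀ i, ∃ m ∈ tight (dualNabla g) ω y, m ≠ 0 ∧ intVec m ∈ convexHull ℝ (g i)}

namespace IsNefData

variable {g : Fin r → Set (Fin d → ℝ)} {T : Finset (Fin d → ℝ)} {ω : (Fin d → ℤ) → ℝ}

/-- Otherwise all vertices lie in other summands, so the component `a i` of `x` is nonpositive on
the whole cell. A point of the cell in the `i`-th summand is nonpositive on the other components
too, contradicting its pairing `1` with `x`. -/
theorem exists_extremePoint_mem (hg : IsNefData g T) {L : Set (Fin d → ℤ)} (hL : L.Finite)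
    (hLP : ∀ m ∈ L, intVec m ∈ dualNabla g) {x : Fin d → ℝ}
    (hx : ∀ n ∈ convexHull ℝ (intVec '' L), n ⬝ᵥ x = 1) {i : Fin r}
    (hi : (convexHull ℝ (intVec '' L) ∩ convexHull ℝ (g i)).Nonempty) :
    ∃ m ∈ L, intVec m ∈ (convexHull ℝ (intVec '' L)).extremePoints ℝ ∧
      intVec m ∈ convexHull ℝ (g i) := by
  obtain ⟨s, hs, hsi⟩ := hi
  obtain ⟨a, ha, hax⟩ := hg.isDecomposing.exists_decomp x
  have hfin : (intVec '' L).Finite := hL.image _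
  have hoff : ∀ j k, j ≠ k → ∀ n ∈ convexHull ℝ (g j), n ⬝ᵥ a k ≤ 0 := fun j k hjk n hn =>
    (hg.dotProduct_le_supportFn hn _).trans (ha.off_le j k hjk)
  have hE : s ∈ convexHull ℝ ((convexHull ℝ (intVec '' L)).extremePoints ℝ) := by
    have hEfin := hfin.subset
      (extremePoints_convexHull_subset (𝕜 := ℝ) (A := intVec '' L))
    rw [← (hEfin.isClosed_convexHull ℝ).closure_eq,
      closure_convexHull_extremePoints (hfin.isCompact_convexHull ℝ) (convex_convexHull ℝ _)]
    exact hs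
  by_contra! hnot
  have hle : s ⬝ᵥ a i ≤ 0 := by
    refine dotProduct_le_of_mem_convexHull (fun v hv => ?_) hE
    obtain ⟨m, hm, rfl⟩ := extremePoints_convexHull_subset hv
    have hm0 : intVec m ≠ 0 := fun h0 => by
      have := hx _ hv.1
      rw [h0, zero_dotProduct] at this
      exact zero_ne_one this
    obtain ⟨k, hk⟩ := hg.exists_mem_of_lattice (hLP m hm) hm0
    exact hoff k i (fun hki => hnot m hm hv (hki ▸ hk)) _ hk
  have h1 := hx s hs
  rw [← hax, dotProduct_sum, ← Finset.add_sum_erase _ _ (Finset.mem_univ i)] at h1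
  have h2 := Finset.sum_nonpos (s := Finset.univ.erase i) (f := fun k => s ⬝ᵥ a k)
    fun k hk => hoff i k (Finset.ne_of_mem_erase hk).symm s hsi
  linarith

theorem nablaOmega_subset_tightLocus (hg : IsNefData g T) :
    nablaOmega (fun i => convexHull ℝ (g i)) ω ⊆ tightLocus g ω := by
  intro y hy
  simp only [nablaOmega, mem_iUnion] at hy
  obtain ⟨σ, ⟨⟨hσ, hσf⟩, htrans⟩, hy⟩ := hy
  obtain ⟨y₁, rfl⟩ := (isCell_iff hg.finite_lattice).1 hσ
  set L := tight (dualNabla g) ω y₁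
  have hLP : ∀ m ∈ L, intVec m ∈ dualNabla g := fun m hm => hm.1
  have hLne : L.Nonempty := tight_nonempty hg.finite_lattice
    ⟨0, by simpa using hg.zero_mem_nablaDual⟩ y₁
  have hσP : convexHull ℝ (intVec '' L) ⊆ dualNabla g :=
    convexHull_min (image_subset_iff.2 hLP) hg.convex_nablaDual
  obtain ⟨x, hx⟩ := exists_supporting hg.convex_nablaDual hg.zero_mem_interior_nablaDual
    (convex_convexHull ℝ _) hσP hσf
  have h0 : intVec (0 : Fin d → ℤ) ∈
      (coneCell (convexHull ℝ (intVec '' L))).extremePoints ℝ := by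
    rw [intVec_zero]
    exact zero_mem_extremePoints_coneCell (convex_convexHull ℝ _) (hLne.image _).convexHull hx
  have h0t : 0 ∈ tight (dualNabla g) ω y :=
    ⟨by simpa using hg.zero_mem_nablaDual, fun m' hm' => hy 0 h0 m' hm'⟩
  refine ⟨h0t, fun i => ?_⟩
  obtain ⟨m, hm, hmE, hmi⟩ := hg.exists_extremePoint_mem (finite_tight hg.finite_lattice y₁) hLP
    hx (htrans i)
  refine ⟨m, ⟨hLP m hm, fun m' hm' => hy m (extremePoints_subset_coneCell
    (convex_convexHull ℝ _) hx hmE) m' hm'⟩, ?_, hmi⟩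
  rintro rfl
  have := hx _ hmE.1
  rw [intVec_zero, zero_dotProduct] at this
  exact zero_ne_one this

end IsNefData

/-- When the origin is tight at both `y` and `z`, the form `y - z` is nonpositive on points tight at
`z` and nonnegative on points tight at `y`. It therefore vanishes at `q`, so `q` uses only points
tight at `z` with `⟨n, y - z⟩ = 0`, and these are tight at `y` as well. -/
theorem mem_convexHull_tight_of_central {P : Set (Fin d → ℝ)} {ω : (Fin d → ℤ) → ℝ}
    (hP : {m | intVec m ∈ P}.Finite) {y z q : Fin d → ℝ} (hy : 0 ∈ tight P ω y)
    (hz : 0 ∈ tight P ω z) {τ : Fin r → ℝ} (hτ : 0 ≤ τ) {m : Fin r → Fin d → ℤ}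
    (hm : ∀ j, m j ∈ tight P ω y) (hq : q = ∑ j, τ j • intVec (m j))
    (hqz : q ∈ convexHull ℝ (intVec '' tight P ω z)) :
    q ∈ convexHull ℝ (intVec '' tight P ω y) := by
  have hval : ∀ {w}, 0 ∈ tight P ω w → ∀ n ∈ tight P ω w, intVec n ⬝ᵥ w = ω n - ω 0 :=
    fun {w} hw n hn => by
      have h1 := hw.2 n hn.1
      have h2 := hn.2 0 hw.1
      rw [intVec_zero, zero_dotProduct] at h1 h2
      linarith
  have hle : ∀ {w}, 0 ∈ tight P ω w → ∀ n, intVec n ∈ P → intVec n ⬝ᵥ w ≤ ω n - ω 0 :=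
    fun {w} hw n hn => by
      have h1 := hw.2 n hn
      rw [intVec_zero, zero_dotProduct] at h1
      linarith
  have hf : ∀ v ∈ intVec '' tight P ω z, v ⬝ᵥ (y - z) ≤ 0 := forall_mem_image.2 fun n hn => by
    rw [dotProduct_sub, hval hz n hn]
    linarith [hle hy n hn.1]
  have hq0 : q ⬝ᵥ (y - z) = 0 := by
    refine (dotProduct_le_of_mem_convexHull hf hqz).antisymm ?_
    rw [hq, sum_dotProduct]
    refine Finset.sum_nonneg fun j _ => ?_
    rw [smul_dotProduct, smul_eq_mul, dotProduct_sub, hval hy _ (hm j)]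
    exact mul_nonneg (hτ j) (by linarith [hle hz (m j) (hm j).1])
  have h1 := mem_convexHull_of_le ((finite_tight hP z).image intVec) (dotLin (y - z)) hqz
    fun v hv => (hf v hv).trans hq0.ge
  refine convexHull_mono ?_ h1
  rintro _ ⟨⟨n, hn, rfl⟩, hnq⟩
  refine ⟨n, ⟨hn.1, fun n' hn' => ?_⟩, rfl⟩
  rw [dotLin_apply, dotLin_apply, hq0, dotProduct_sub, hval hz n hn] at hnq
  linarith [hle hy n' hn']

namespace IsNefData

variable {g : Fin r → Set (Fin d → ℝ)} {T : Finset (Fin d → ℝ)} {ω : (Fin d → ℤ) → ℝ}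

/-- The map `t ↦ (max (0, ⟨∑ j, t j • n j, v⟩))` over the faces, for `n j` in the `j`-th summand. -/
theorem isOffAntitone_face (hg : IsNefData g T) {n : Fin r → Fin d → ℝ}
    (hn : ∀ j, n j ∈ convexHull ℝ (g j))
    (hne : ∀ t : Fin r → ℝ, 0 ≤ t → t ≠ 0 → ∑ j, t j • n j ≠ 0) :
    IsOffAntitone fun t i => supportFn (insert 0 (face g T i : Set (Fin d → ℝ)))
      (∑ j, t j • n j) where
  continuous i := (continuous_supportFn ((face g T i).finite_toSet.insert 0)
    (insert_nonempty _ _)).comp (by fun_prop)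
  hom i t c hc := by
    rw [← supportFn_smul ((face g T i).finite_toSet.insert 0) (insert_nonempty _ _) hc]
    simp [Finset.smul_sum, mul_smul]
  anti i t t' hle hi := by
    refine supportFn_le (insert_nonempty _ _) fun v hv => le_trans ?_
      (le_supportFn ((face g T i).finite_toSet.insert 0) hv _)
    simp only [dotProduct_sum, dotProduct_smul, smul_eq_mul]
    refine Finset.sum_le_sum fun j _ => ?_
    rcases eq_or_ne j i with rfl | hij
    · rw [hi]
    · refine mul_le_mul_of_nonpos_right (hle j) ?_
      rcases hv with rfl | hv
      · rw [zero_dotProduct]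
      · rw [dotProduct_comm]
        exact (hg.dotProduct_le_supportFn (hn j) v).trans
          (hg.supportFn_of_mem_face hv hij).le
  pos t ht ht0 := by
    by_contra! h
    refine hne t ht ht0 (hg.eq_zero_of_face_le fun j v hv => ?_)
    rw [dotProduct_comm]
    exact (le_supportFn ((face g T j).finite_toSet.insert 0) (mem_insert_of_mem _ hv) _).trans
      (h j)

/-- The required cell is cut out of the tight points of `y` by a form `x = ∑ v i`, with one `v i`
from each face. A balanced positive combination `q` of the chosen `m j` pairs to `1/r` with every `v
i`. Hence `q` is a boundary point on the hyperplane `⟨·, x⟩ = 1`, and the cell through it must meet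
every summand. -/
theorem tightLocus_subset_nablaOmega (hg : IsNefData g T) (hω : IsCentral (dualNabla g) ω) :
    tightLocus g ω ⊆ nablaOmega (fun i => convexHull ℝ (g i)) ω := by
  rintro y ⟨hy0, hy⟩
  choose m hmt hm0 hmi using hy
  have hr : (0 : ℝ) < r := by exact_mod_cast hg.one_le
  have hfin := hg.finite_lattice
  obtain ⟨y₀, hy₀⟩ := exists_strict_center hfin hω
  -- The strict center shows that the `m j` lie in an open half-space, so no nontrivial nonnegative
  -- combination of them vanishes.
  have hpos : ∀ j, 0 < intVec (m j) ⬝ᵥ (y - y₀) := fun j => by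
    have h1 := (hmt j).2 0 hy0.1
    have h2 := hy₀ (m j) (hmt j).1 (hm0 j)
    rw [intVec_zero, zero_dotProduct] at h1
    rw [dotProduct_sub]
    linarith
  have hne : ∀ t : Fin r → ℝ, 0 ≤ t → t ≠ 0 → ∑ j, t j • intVec (m j) ≠ 0 := by
    intro t ht ht0 h0
    obtain ⟨k, hk⟩ := Function.ne_iff.1 ht0
    have h1 : 0 < ∑ j, t j * (intVec (m j) ⬝ᵥ (y - y₀)) :=
      Finset.sum_pos' (fun j _ => mul_nonneg (ht j) (hpos j).le)
        ⟨k, Finset.mem_univ k, mul_pos ((ht k).lt_of_ne (Ne.symm hk)) (hpos k)⟩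
    have h2 := congrArg (· ⬝ᵥ (y - y₀)) h0
    simp only [sum_dotProduct, smul_dotProduct, smul_eq_mul, zero_dotProduct] at h2
    exact h1.ne' h2
  obtain ⟨t, ht, ht1⟩ := (hg.isOffAntitone_face hmi hne).exists_eq_one
  set p := ∑ j, t j • intVec (m j) with hp
  have hv : ∀ i, ∃ v ∈ face g T i, v ⬝ᵥ p = 1 := fun i => by
    obtain ⟨v, hv, hvp⟩ := exists_eq_supportFn ((face g T i).finite_toSet.insert 0)
      (insert_nonempty _ _) p
    rw [ht1 i] at hvp
    rcases hv with rfl | hv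
    · rw [zero_dotProduct] at hvp
      exact absurd hvp zero_ne_one
    · exact ⟨v, hv, hvp⟩
  choose v hv hvp using hv
  set x := ∑ i, v i with hx
  have hxφ : ∀ k, supportFn (g k) x ≤ 1 := fun k => by
    refine (supportFn_sum_le (hg.finite k) (hg.nonempty k) _ _).trans ?_
    simp [fun i => hg.supportFn_face_le (hv i) k]
  have hxP : ∀ n ∈ dualNabla g, n ⬝ᵥ x ≤ 1 := fun n hn => (hg.mem_nablaDual_iff n).1 hn x hxφ
  set q := (r : ℝ)⁻¹ • p with hq
  have hqv : ∀ i, q ⬝ᵥ v i = (r : ℝ)⁻¹ := fun i => by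
    rw [hq, smul_dotProduct, dotProduct_comm, hvp, smul_eq_mul, mul_one]
  have hqx : q ⬝ᵥ x = 1 := by
    rw [hx, dotProduct_sum]
    simp [hqv, hr.ne']
  have hqP : q ∈ dualNabla g := (hg.mem_nablaDual_iff q).2 fun z hz => by
    have h1 := hg.dotProduct_le_of_face (m := p) (κ := 1) (fun j w hw => by
      rw [dotProduct_comm, Pi.one_apply, ← ht1 j]
      exact le_supportFn ((face g T j).finite_toSet.insert 0) (mem_insert_of_mem _ hw) _) z
    have h2 : ∑ j, (1 : Fin r → ℝ) j * supportFn (g j) z ≤ r := by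
      refine (Finset.sum_le_sum fun j _ => ?_).trans_eq (b := ∑ _j : Fin r, (1 : ℝ)) (by simp)
      rw [Pi.one_apply, one_mul]
      exact hz j
    rw [hq, smul_dotProduct, smul_eq_mul, inv_mul_le_one₀ hr]
    exact h1.trans h2
  have hqy : q ∈ convexHull ℝ (intVec '' tight (dualNabla g) ω y) := by
    -- Covering by cells is available only at interior points, so `q` is approached along its ray by
    -- `s • q` with `s < 1`; the hull of the tight points is closed.
    have hin : ∀ s ∈ Ico (0 : ℝ) 1,
        s • q ∈ convexHull ℝ (intVec '' tight (dualNabla g) ω y) := fun s hs => by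
      have hint : s • q ∈ interior (dualNabla g) := by
        have := hg.convex_nablaDual.combo_interior_self_mem_interior
          hg.zero_mem_interior_nablaDual hqP (a := 1 - s) (b := s) (by linarith [hs.2]) hs.1
          (by ring)
        rwa [smul_zero, zero_add] at this
      obtain ⟨y₁, hy₁⟩ := exists_mem_cell (ω := ω) hfin hg.convexHull_lattice hint
      obtain ⟨y₂, hsub, hy₂, -⟩ := exists_central_cell hfin hω y₁
      refine mem_convexHull_tight_of_central hfin hy0 hy₂
        (τ := fun j => s * ((r : ℝ)⁻¹ * t j))
        (fun j => mul_nonneg hs.1 (mul_nonneg (inv_pos.2 hr).le (ht j))) hmt ?_ (hsub hy₁)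
      simp only [hq, hp, mul_smul, ← Finset.smul_sum]
    have hcl := ((finite_tight (ω := ω) hfin y).image intVec).isClosed_convexHull ℝ
    have hc : Continuous fun s : ℝ => s • q := by fun_prop
    have hcls : (1 : ℝ) ∈ closure (Ico (0 : ℝ) 1) := by
      rw [closure_Ico zero_ne_one]
      exact right_mem_Icc.2 zero_le_one
    have : (1 : ℝ) • q ∈ convexHull ℝ (intVec '' tight (dualNabla g) ω y) :=
      closure_minimal hin (hcl.preimage hc) hcls
    rwa [one_smul] at this
  have hqS := mem_convexHull_of_le ((finite_tight hfin y).image intVec) (dotLin x) hqy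
    (forall_mem_image.2 fun n hn => (hxP _ hn.1).trans hqx.ge)
  set S : Set (Fin d → ℤ) := {n | n ∈ tight (dualNabla g) ω y ∧ intVec n ⬝ᵥ x = 1} with hS
  have hqS : q ∈ convexHull ℝ (intVec '' S) := by
    refine convexHull_mono ?_ hqS
    rintro _ ⟨⟨n, hn, rfl⟩, hnx⟩
    exact ⟨n, ⟨hn, hnx.trans hqx⟩, rfl⟩
  have hSi : ∀ i, ∃ n ∈ S, intVec n ∈ convexHull ℝ (g i) := fun i => by
    by_contra! hnot
    -- Summands other than the `i`-th are nonpositive on `v i`, whereas `q` pairs with it to `1/r >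
    -- 0`.
    have h1 : q ⬝ᵥ v i ≤ 0 := by
      refine dotProduct_le_of_mem_convexHull (forall_mem_image.2 fun n hn => ?_) hqS
      have hn0 : intVec n ≠ 0 := fun h0 => by
        have := hn.2
        rw [h0, zero_dotProduct] at this
        exact zero_ne_one this
      obtain ⟨k, hk⟩ := hg.exists_mem_of_lattice hn.1.1 hn0
      have hki : k ≠ i := fun h => hnot n hn (h ▸ hk)
      exact (hg.dotProduct_le_supportFn hk _).trans (hg.supportFn_of_mem_face (hv i) hki).le
    rw [hqv] at h1
    exact (inv_pos.2 hr).not_ge h1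
  have hSP : convexHull ℝ (intVec '' S) ⊆ dualNabla g :=
    convexHull_min (image_subset_iff.2 fun n hn => hn.1.1) hg.convex_nablaDual
  have hSx : ∀ n ∈ convexHull ℝ (intVec '' S), n ⬝ᵥ x = 1 := fun n hn => by
    refine (hxP n (hSP hn)).antisymm ?_
    have := dotProduct_le_of_mem_convexHull (x := -x) (c := -1) (forall_mem_image.2 fun k hk => by
      rw [dotProduct_neg, hk.2]) hn
    rw [dotProduct_neg] at this
    linarith
  have hfront : convexHull ℝ (intVec '' S) ⊆ frontier (dualNabla g) := fun n hn => by
    refine ⟨subset_closure (hSP hn), fun hint => ?_⟩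
    have hc : Continuous fun s : ℝ => s • n := by fun_prop
    have hev : ∀ᶠ s in 𝓝[>] (1 : ℝ), s • n ∈ dualNabla g :=
      nhdsWithin_le_nhds (hc.continuousAt.eventually_mem
        (by rw [one_smul]; exact mem_interior_iff_mem_nhds.1 hint))
    obtain ⟨s, hs, hs1⟩ := (hev.and self_mem_nhdsWithin).exists
    have hs1 : 1 < s := hs1
    have := hxP _ hs
    rw [smul_dotProduct, hSx n hn, smul_eq_mul, mul_one] at this
    exact this.not_gt hs1
  -- A small step from `y` along `x` realizes `S` as the full set of tight points of a cell.
  obtain ⟨δ, hδ, hpert⟩ := exists_pos_perturb (ω := ω) hfin y x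
  have hcell : tight (dualNabla g) ω (y + δ • x) = S := by
    refine tight_add_smul hδ hpert (fun n hn => hxP _ hn.1) ?_
    obtain ⟨n, hn, -⟩ := hSi ⟨0, hg.one_le⟩
    exact ⟨n, hn⟩
  simp only [nablaOmega, mem_iUnion]
  refine ⟨convexHull ℝ (intVec '' S), ⟨⟨(isCell_iff hfin).2 ⟨_, by rw [← hcell]⟩, hfront⟩,
    fun i => ?_⟩, ?_⟩
  · obtain ⟨n, hn, hni⟩ := hSi i
    exact ⟨_, subset_convexHull ℝ _ (mem_image_of_mem _ hn), hni⟩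
  · intro n hn
    have hn' : n ∈ tight (dualNabla g) ω y := by
      rw [coneCell, convexHull_convexHull_union_right] at hn
      rcases extremePoints_convexHull_subset hn with h0 | ⟨k, hk, hkn⟩
      · rwa [intVec_eq_zero.1 h0]
      · rw [← intVec_injective hkn]
        exact hk.1
    exact fun m' hm' => hn'.2 m' hm'

/-! ### The tight locus as a level set, and the conclusion. -/

/-- The points `m / (ω m - ω 0 - ⟨m, y₀⟩)` for the nonzero lattice points `m` of the `i`-th summand,
together with the origin. -/
def scaledPoints (g : Fin r → Set (Fin d → ℝ)) (ω : (Fin d → ℤ) → ℝ) (y₀ : Fin d → ℝ)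
    (i : Fin r) : Set (Fin d → ℝ) :=
  insert 0 ((fun m => (ω m - ω 0 - intVec m ⬝ᵥ y₀)⁻¹ • intVec m) ''
    {m | intVec m ∈ dualNabla g ∧ m ≠ 0 ∧ intVec m ∈ convexHull ℝ (g i)})

theorem finite_scaledPoints (hg : IsNefData g T) (y₀ : Fin d → ℝ) (i : Fin r) :
    (scaledPoints g ω y₀ i).Finite :=
  ((hg.finite_lattice.subset fun _ hm => hm.1).image _).insert 0

variable {y₀ : Fin d → ℝ}

theorem isAdmissible_scaledPoints (hg : IsNefData g T)
    (hy₀ : ∀ m, intVec m ∈ dualNabla g → m ≠ 0 → intVec m ⬝ᵥ y₀ - ω m < -ω 0) :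
    IsAdmissible g (scaledPoints g ω y₀) where
  finite := hg.finite_scaledPoints y₀
  nonempty i := insert_nonempty _ _
  nonpos i := by
    rintro _ (rfl | ⟨m, ⟨hm, hm0, hmi⟩, rfl⟩) x hx
    · rw [zero_dotProduct]
    · rw [smul_dotProduct, smul_eq_mul]
      exact mul_nonpos_of_nonneg_of_nonpos (inv_nonneg.2 (by linarith [hy₀ m hm hm0]))
        ((hg.dotProduct_le_supportFn hmi x).trans hx)
  pos x hx := by
    obtain ⟨i, hi⟩ := hg.pos x hx
    obtain ⟨n, hn, hnx⟩ := exists_eq_supportFn (hg.finite i) (hg.nonempty i) x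
    obtain ⟨m, rfl⟩ := hg.integral i n hn
    rw [← hnx] at hi
    have hmi := subset_convexHull ℝ _ hn
    have hm0 : m ≠ 0 := by
      rintro rfl
      simp at hi
    have hmP := hg.convexHull_subset_nablaDual i hmi
    refine ⟨i, lt_of_lt_of_le ?_ (le_supportFn (hg.finite_scaledPoints y₀ i)
      (mem_insert_of_mem _ ⟨m, ⟨hmP, hm0, hmi⟩, rfl⟩) x)⟩
    rw [smul_dotProduct, smul_eq_mul]
    exact mul_pos (inv_pos.2 (by linarith [hy₀ m hmP hm0])) hi

theorem mem_tightLocus_iff (hg : IsNefData g T)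
    (hy₀ : ∀ m, intVec m ∈ dualNabla g → m ≠ 0 → intVec m ⬝ᵥ y₀ - ω m < -ω 0)
    (y : Fin d → ℝ) : y ∈ tightLocus g ω ↔ y - y₀ ∈ levelSet (scaledPoints g ω y₀) := by
  -- Dividing by the positive gap at `y₀` turns "not above the origin" into `≤ 1` and tightness into
  -- `= 1`.
  have hle : ∀ m, intVec m ∈ dualNabla g → m ≠ 0 →
      ((((ω m - ω 0 - intVec m ⬝ᵥ y₀)⁻¹ • intVec m) ⬝ᵥ (y - y₀) ≤ 1 ↔
        intVec m ⬝ᵥ y - ω m ≤ -ω 0) ∧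
      (((ω m - ω 0 - intVec m ⬝ᵥ y₀)⁻¹ • intVec m) ⬝ᵥ (y - y₀) = 1 ↔
        intVec m ⬝ᵥ y - ω m = -ω 0)) := fun m hm hm0 => by
    have hc : 0 < ω m - ω 0 - intVec m ⬝ᵥ y₀ := by linarith [hy₀ m hm hm0]
    rw [smul_dotProduct, smul_eq_mul, inv_mul_le_one₀ hc, inv_mul_eq_one₀ hc.ne', dotProduct_sub]
    exact ⟨⟨fun h => by linarith, fun h => by linarith⟩,
      ⟨fun h => by linarith, fun h => by linarith⟩⟩
  have h0P : intVec (0 : Fin d → ℤ) ∈ dualNabla g := by simpa using hg.zero_mem_nablaDual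
  constructor
  · rintro ⟨h0, h⟩ i
    have htight : ∀ m, intVec m ∈ dualNabla g → intVec m ⬝ᵥ y - ω m ≤ -ω 0 := fun m hm => by
      simpa using h0.2 m hm
    apply le_antisymm
    · refine supportFn_le (insert_nonempty _ _) ?_
      rintro _ (rfl | ⟨m, ⟨hm, hm0, hmi⟩, rfl⟩)
      · rw [zero_dotProduct]
        exact zero_le_one
      · exact (hle m hm hm0).1.2 (htight m hm)
    · obtain ⟨m, hm, hm0, hmi⟩ := h i
      have heq : intVec m ⬝ᵥ y - ω m = -ω 0 :=
        (htight m hm.1).antisymm (by simpa using hm.2 0 h0P)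
      rw [← (hle m hm.1 hm0).2.2 heq]
      exact le_supportFn (hg.finite_scaledPoints y₀ i)
        (mem_insert_of_mem _ ⟨m, ⟨hm.1, hm0, hmi⟩, rfl⟩) _
  · intro h
    have htight : ∀ m, intVec m ∈ dualNabla g → intVec m ⬝ᵥ y - ω m ≤ -ω 0 := fun m hm => by
      rcases eq_or_ne m 0 with rfl | hm0
      · simp
      obtain ⟨i, hi⟩ := hg.exists_mem_of_lattice hm (fun h => hm0 (intVec_eq_zero.1 h))
      refine (hle m hm hm0).1.1 ?_
      rw [← h i]
      exact le_supportFn (hg.finite_scaledPoints y₀ i)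
        (mem_insert_of_mem _ ⟨m, ⟨hm, hm0, hi⟩, rfl⟩) _
    refine ⟨⟨h0P, fun m hm => by simpa using htight m hm⟩, fun i => ?_⟩
    obtain ⟨b, hb, hbx⟩ := exists_eq_supportFn (hg.finite_scaledPoints (ω := ω) y₀ i)
      (insert_nonempty _ _) (y - y₀)
    rw [h i] at hbx
    rcases hb with rfl | ⟨m, ⟨hm, hm0, hmi⟩, rfl⟩
    · rw [zero_dotProduct] at hbx
      exact absurd hbx zero_ne_one
    · have heq := (hle m hm hm0).2.1 hbx
      exact ⟨m, ⟨hm, fun m' hm' => heq ▸ htight m' hm'⟩, hm0, hmi⟩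

end IsNefData

end NefSphere

theorem mainTheorem1 {d r : ℕ} (hr : 1 ≤ r) (Δ : Fin r → Set (Fin d → ℝ))
    (hΔ : NefSphere.IsNefPartition Δ) (hirr : NefSphere.IsIrreducible Δ)
    (ω : (Fin d → ℤ) → ℝ) (hω : NefSphere.IsCentral (NefSphere.nablaDual Δ) ω) :
    r ≤ d + 1 ∧
    Nonempty (NefSphere.nablaOmega Δ ω ≃ₜ
      Metric.sphere (0 : EuclideanSpace ℝ (Fin (d + 1 - r))) 1) := by
  obtain ⟨g, T, hg, rfl⟩ := hΔ.exists_data hr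
  obtain ⟨p, hp, hpg⟩ := hg.exists_circuit hirr
  -- The common kernel of the `p i` has dimension `k` with `k + r = d + 1`; this gives the
  -- inequality and makes the truncated subtraction `d + 1 - r` exact.
  refine ⟨by have := hp.finrank_ker_evalForms hr; omega, ?_⟩
  obtain ⟨y₀, hy₀⟩ := NefSphere.exists_strict_center hg.finite_lattice hω
  obtain ⟨e⟩ := NefSphere.nonempty_levelSet_homeomorph_sphere hr hg.isDecomposing hp hpg
    (hg.isAdmissible_scaledPoints hy₀)
  have hset : NefSphere.nablaOmega (fun i => convexHull ℝ (g i)) ω =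
      NefSphere.tightLocus g ω :=
    Set.Subset.antisymm hg.nablaOmega_subset_tightLocus (hg.tightLocus_subset_nablaOmega hω)
  have hsub : NefSphere.nablaOmega (fun i => convexHull ℝ (g i)) ω =
      Homeomorph.subRight y₀ ⁻¹' NefSphere.levelSet (NefSphere.IsNefData.scaledPoints g ω y₀) := by
    rw [hset]
    exact Set.ext (hg.mem_tightLocus_iff hy₀)
  exact ⟨((Homeomorph.setCongr hsub).trans
    ((Homeomorph.subRight y₀).sets rfl)).trans e⟩
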